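/- Let $\mathcal X$ be a finite alphabet. Fix: (a) An additively optimal conditional prefix machine $U$. Given the whole condition $x\in\mathcal X^*$, such a machine reads a binary program bit by bit without end markers; $U(p,x)=y$ means that it halts with output $y\in\mathbb N$ after reading exactly $p$. Put $K(y|x)=\min\{\ell(p):U(p,x)=y\}$ and $K(y)=K(y|\epsilon)$; integers are coded by natural numbers in a standard way. (b) An optimal twice prefix machine $W$. A twice prefix machine has two input tapes without delimiters, a binary one and one over $\mathcal X$; $W(p,x)=y$ means that it halts with output $y$ after reading exactly $p$ on the first and exactly $x$ on the second tape. Put $K_*(y|x*)=\min\{\ell(p):\exists k\le\ell(x),\ W(p,x_{1:k})=y\}$. Optimal means: for every twice prefix machine this quantity is at most the corresponding one of that machine plus a constant. (c) An effective enumeration $(\nu_T)_{T\in\mathbb N}$ of all enumerable semimeasures on $\mathcal X^*$. For a measure $\mu=\nu_T$, i.e. for a code $T$ of $\mu$, write $K(\mu|x)=K(T|x)$ and $K_*(\mu|x*)=K_*(T|x*)$. Let $M(x)=\sum_T 2^{-K(T)}\nu_T(x)$ be Solomonoff's prior, $\rho(y|x)=\rho(xy)/\rho(x)$, and $d_\mu(x)=\log_2\frac{M(x)}{\mu(x)}$.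 A measure $\mu$ on $\mathcal X^*$ is computable if it is enumerable and co-enumerable and $\{x:\mu(x)=0\}$ is decidable. With $M_t=M(\cdot|\omega_{<t})$ and $\mu_t=\mu(\cdot|\omega_{<t})$, let $s_t$ be any one of $\sum_a(M_t(a)-\mu_t(a))^2$, $\frac12\bigl(\sum_a|M_t(a)-\mu_t(a)|\bigr)^2$, $\sum_a\bigl(\sqrt{M_t(a)}-\sqrt{\mu_t(a)}\bigr)^2$, $\sum_a\mu_t(a)\ln\frac{\mu_t(a)}{M_t(a)}$, or $\frac12(l^{M}_t-l^{\mu}_t)^2$, where $l^\rho_t=\inf_y\sum_a\mathrm{Loss}(a,y)\,\rho(a|\omega_{<t})$ for a loss function with values in $[0,1]$ and a nonempty set of actions $y$. Let $\mathbf E$ be the expectation over $\omega$ drawn from $\mu$. There is a constant $c$, depending only on $\mathcal X,U,W$ and $(\nu_T)$, such that for every computable measure $\mu$, every code of $\mu$, every $l\ge0$ and every $\omega_{1:l}\in\mathcal X^l$ with $\mu(\omega_{1:l})>0$, the series below converges for each choice of $s_t$ and $$\sum_{t=l+1}^\infty \mathbf E[s_t\mid\omega_{1:l}]\;\le\;\bigl[K_*(\mu|\omega_{1:l}*)+K(\lceil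 d_\mu(\omega_{1:l})\rceil)\bigr]\ln 2+c ,$$ $$\bigl[K_*(\mu|\omega_{1:l}*)+K(\lceil d_\mu(\omega_{1:l})\rceil)\bigr]\ln 2\;\le\;\Bigl[\min_{0\le i\le l}\{K(\mu|\omega_{1:i})+K(i)\}+K(\lceil d_\mu(\omega_{1:l})\rceil)\Bigr]\ln 2+c .$$ -/

import Mathlib

universe u v

namespace AlgorithmicPrediction

/-! ## Prefix complexity -/

/-- A conditional prefix (self-delimiting) machine. The condition `x` over the alphabet `X` is given
in full; the binary program is read from a one-way tape without delimiters, bit after bit.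
`next (x, p)` is what the machine does once it has read exactly `p` from the program tape:
`none` means that it requests one more bit, `some y` that it halts with output `y`, and it is
undefined if the machine runs forever without reading further. -/
structure PrefixMachine (X : Type u) [Primcodable X] where
  next : List X × List Bool →. Option ℕ
  partrec : Partrec next

namespace PrefixMachine

variable {X : Type u} [Primcodable X]

/-- `U(p, x) = y`: with condition `x`, the machine halts with output `y` after reading exactly `p`
from the program tape. -/
def Outputs (U : PrefixMachine X) (p : List Bool) (x : List X) (y : ℕ) : Prop :=
  (∀ k < p.length, none ∈ U.next (x, p.take k)) ∧ some y ∈ U.next (x, p)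

/-- `min {ℓ(p) : U(p, x) = y}`, which is `⊤` if there is no such program. -/
noncomputable def complexity (U : PrefixMachine X) (y : ℕ) (x : List X) : ℕ∞ :=
  ⨅ (p : List Bool) (_ : U.Outputs p x y), (p.length : ℕ∞)

/-- `U` is a universal (additively optimal) prefix machine. -/
def IsOptimal (U : PrefixMachine X) : Prop :=
  ∀ V : PrefixMachine X, ∃ c : ℕ, ∀ (y : ℕ) (x : List X),
    U.complexity y x ≤ V.complexity y x + c

/-- The conditional prefix complexity `K(y|x)` (for an optimal machine the minimum is finite,
see `complexity_ne_top`). -/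
noncomputable def K (U : PrefixMachine X) (y : ℕ) (x : List X) : ℕ :=
  (U.complexity y x).toNat

theorem complexity_ne_top {U : PrefixMachine X} (hU : U.IsOptimal) (y : ℕ) (x : List X) :
    U.complexity y x ≠ ⊤ := by
  obtain ⟨c, hc⟩ := hU ⟨fun _ => Part.some (some y), (Computable.const (some y)).partrec⟩
  have h := hc y x
  refine ne_top_of_le_ne_top ?_ h
  refine ne_top_of_le_ne_top (b := (0 : ℕ∞) + c) (by simp) ?_
  gcongr
  refine iInf₂_le_of_le [] ?_ (by simp)
  exact ⟨by simp, by simp⟩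

end PrefixMachine

/-! ## Complexity monotone in conditions -/

/-- A twice prefix machine: it has two one-way input tapes without delimiters, a binary one for
the program and one over `X` for the condition. `next (p, x)` is what the machine does once it has
read exactly `p` from the program tape and exactly `x` from the condition tape: `inl false` means
that it requests the next program bit, `inl true` that it requests the next symbol of the condition,
`inr y` that it halts with output `y`, and it is undefined if the machine runs forever without
reading further. -/
structure TwicePrefixMachine (X : Type u) [Primcodable X] where
  next : List Bool × List X →. Bool ⊕ ℕ
  partrec : Partrec next

namespace TwicePrefixMachine

variable {X : Type u} [Primcodable X]

/-- `T.Reads p x`: given sequences that begin with `p` and `x` on its two tapes, the machine arrives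
at a moment when it has read exactly `p` and `x`. -/
inductive Reads (T : TwicePrefixMachine X) : List Bool → List X → Prop
  | start : Reads T [] []
  | readProgram {p : List Bool} {x : List X} (b : Bool) :
      Reads T p x → Sum.inl false ∈ T.next (p, x) → Reads T (p ++ [b]) x
  | readCondition {p : List Bool} {x : List X} (a : X) :
      Reads T p x → Sum.inl true ∈ T.next (p, x) → Reads T p (x ++ [a])

/-- `T(p, x) = y`: given sequences that begin with `p` and `x` on its two tapes, the machine halts
after reading exactly `p` and `x`, with output `y`. -/
def Outputs (T : TwicePrefixMachine X) (p : List Bool) (x : List X) (y : ℕ) : Prop :=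
  T.Reads p x ∧ Sum.inr y ∈ T.next (p, x)

/-- `C_T(y|x) = min {ℓ(p) : ∃ k ≤ ℓ(x), T(p, x_{1:k}) = y}`, which is `⊤` if there is no such
program. -/
noncomputable def complexity (T : TwicePrefixMachine X) (y : ℕ) (x : List X) : ℕ∞ :=
  ⨅ (p : List Bool) (_ : ∃ k ≤ x.length, T.Outputs p (x.take k) y), (p.length : ℕ∞)

/-- `U` is an optimal twice prefix machine. -/
def IsOptimal (U : TwicePrefixMachine X) : Prop :=
  ∀ T : TwicePrefixMachine X, ∃ c : ℕ, ∀ (y : ℕ) (x : List X),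
    U.complexity y x ≤ T.complexity y x + c

/-- The complexity monotone in conditions `K_*(y|x*)` (for an optimal machine the minimum is finite,
see `complexity_ne_top`). -/
noncomputable def KStar (U : TwicePrefixMachine X) (y : ℕ) (x : List X) : ℕ :=
  (U.complexity y x).toNat

theorem complexity_ne_top {U : TwicePrefixMachine X} (hU : U.IsOptimal) (y : ℕ) (x : List X) :
    U.complexity y x ≠ ⊤ := by
  obtain ⟨c, hc⟩ := hU ⟨fun _ => Part.some (Sum.inr y), (Computable.const (Sum.inr y)).partrec⟩
  have h := hc y x
  refine ne_top_of_le_ne_top ?_ h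
  refine ne_top_of_le_ne_top (b := (0 : ℕ∞) + c) (by simp) ?_
  gcongr
  refine iInf₂_le_of_le [] ?_ (by simp)
  exact ⟨0, by simp, Reads.start, by simp⟩

end TwicePrefixMachine

/-! ## Semimeasures and measures -/

section Semimeasures

variable {X : Type u} [Fintype X]

/-- Semimeasures on the finite strings over `X` (the bound `ρ x ≤ 1` follows). -/
structure IsSemimeasure (ρ : List X → ℝ) : Prop where
  nonneg : ∀ x, 0 ≤ ρ x
  root_le : ρ [] ≤ 1
  sum_le : ∀ x, ∑ a, ρ (x ++ [a]) ≤ ρ x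

/-- (Proper probability) measures. -/
structure IsMeasure (ρ : List X → ℝ) : Prop where
  nonneg : ∀ x, 0 ≤ ρ x
  root_eq : ρ [] = 1
  sum_eq : ∀ x, ∑ a, ρ (x ++ [a]) = ρ x

/-- A nonnegative function is enumerable if the set of pairs `(x, k/n)` with `f x > k/n` is.
(For a nonnegative function the negative rationals may be left out.) -/
def IsEnumerable {α : Type u} [Primcodable α] (f : α → ℝ) : Prop :=
  REPred fun q : α × ℕ × ℕ => (q.2.1 : ℝ) / ((q.2.2 : ℝ) + 1) < f q.1

/-- A nonnegative function is co-enumerable if the set of pairs `(x, k/n)` with `f x < k/n` is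
enumerable. -/
def IsCoEnumerable {α : Type u} [Primcodable α] (f : α → ℝ) : Prop :=
  REPred fun q : α × ℕ × ℕ => f q.1 < (q.2.1 : ℝ) / ((q.2.2 : ℝ) + 1)

/-- Computable measures. -/
structure IsComputableMeasure [Primcodable X] (μ : List X → ℝ) : Prop where
  isMeasure : IsMeasure μ
  enumerable : IsEnumerable μ
  coEnumerable : IsCoEnumerable μ
  decidable_zero : ComputablePred fun x => μ x = 0

/-- `ν 0, ν 1, …` is an effective enumeration of all enumerable semimeasures. An index `T` with
`ν T = μ` is a code of `μ`. -/
structure IsSemimeasureEnumeration [Primcodable X] (ν : ℕ → List X → ℝ) : Prop where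
  isSemimeasure : ∀ T, IsSemimeasure (ν T)
  enumerable : REPred fun q : (ℕ × List X) × ℕ × ℕ =>
    (q.2.1 : ℝ) / ((q.2.2 : ℝ) + 1) < ν q.1.1 q.1.2
  complete : ∀ ρ : List X → ℝ, IsSemimeasure ρ → IsEnumerable ρ → ∃ T, ν T = ρ

/-- The conditional probability `ρ(y|x) = ρ(xy)/ρ(x)`; it is only used where `ρ(x) ≠ 0` or with
weight zero. -/
noncomputable def cond (ρ : List X → ℝ) (x y : List X) : ℝ := ρ (x ++ y) / ρ x

/-- The predictive distribution `a ↦ ρ(a|x)` of the next symbol. -/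
noncomputable def predictive (ρ : List X → ℝ) (x : List X) (a : X) : ℝ := cond ρ x [a]

/-- Solomonoff's prior: the mixture `M(x) = ∑_T 2^{-K(T)} ν_T(x)` of all enumerable semimeasures. -/
noncomputable def solomonoffPrior [Primcodable X] (U : PrefixMachine X) (ν : ℕ → List X → ℝ)
    (x : List X) : ℝ :=
  ∑' T : ℕ, (2 : ℝ)⁻¹ ^ (U.K T []) * ν T x

/-- The randomness deficiency `d_μ(x) = log₂ (M(x)/μ(x))`. -/
noncomputable def deficiency (M μ : List X → ℝ) (x : List X) : ℝ :=
  Real.logb 2 (M x / μ x)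

/-- The complexity `K(d)` of an integer, through its standard code as a natural number. -/
noncomputable def PrefixMachine.KInt [Primcodable X] (U : PrefixMachine X) (d : ℤ) : ℕ :=
  U.K (Encodable.encode d) []

end Semimeasures

/-! ## Deviations of predictions -/

section Deviations

variable {X : Type u} [Fintype X]

/-- `∑_a (ρ_a - μ_a)²` -/
noncomputable def squaredDistance (ρ μ : X → ℝ) : ℝ := ∑ a, (ρ a - μ a) ^ 2

/-- `½ (∑_a |ρ_a - μ_a|)²` -/
noncomputable def squaredAbsoluteDistance (ρ μ : X → ℝ) : ℝ := 1 / 2 * (∑ a, |ρ a - μ a|) ^ 2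

/-- `∑_a (√ρ_a - √μ_a)²` -/
noncomputable def hellingerDistance (ρ μ : X → ℝ) : ℝ := ∑ a, (√(ρ a) - √(μ a)) ^ 2

/-- `∑_a μ_a ln (μ_a/ρ_a)` -/
noncomputable def klDivergence (ρ μ : X → ℝ) : ℝ := ∑ a, μ a * Real.log (μ a / ρ a)

/-- The minimal `ρ`-expected loss `min_y ∑_a Loss(a, y) ρ_a`. -/
noncomputable def bayesLoss {Y : Type v} (loss : X → Y → ℝ) (ρ : X → ℝ) : ℝ :=
  ⨅ y, ∑ a, loss a y * ρ a

/-- `½ (l^ρ - l^μ)²` -/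
noncomputable def squaredBayesRegret {Y : Type v} (loss : X → Y → ℝ) (ρ μ : X → ℝ) : ℝ :=
  1 / 2 * (bayesLoss loss ρ - bayesLoss loss μ) ^ 2

/-- The measures `s(ρ_t, μ_t)` of the deviation of the prediction `ρ_t` from the true `μ_t`. -/
inductive IsDeviation : ((X → ℝ) → (X → ℝ) → ℝ) → Prop
  | squared : IsDeviation squaredDistance
  | squaredAbsolute : IsDeviation squaredAbsoluteDistance
  | hellinger : IsDeviation hellingerDistance
  | kl : IsDeviation klDivergence
  | regret {Y : Type v} [Nonempty Y] (loss : X → Y → ℝ)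
      (h : ∀ a y, loss a y ∈ Set.Icc (0 : ℝ) 1) : IsDeviation (squaredBayesRegret loss)

/-- `E[s_t | ω_{1:l} = x]` for `t = l + 1 + n`, where `l = ℓ(x)` and
`s_t = s(M(·|ω_{<t}), μ(·|ω_{<t}))`: the sum over all strings `z` of length `n` of
`μ(z|x) s(M(·|xz), μ(·|xz))`. -/
noncomputable def expectedDeviation (s : (X → ℝ) → (X → ℝ) → ℝ) (M μ : List X → ℝ)
    (x : List X) (n : ℕ) : ℝ :=
  ∑ z : Fin n → X, cond μ x (List.ofFn z) *
    s (predictive M (x ++ List.ofFn z)) (predictive μ (x ++ List.ofFn z))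

end Deviations

end AlgorithmicPrediction

open AlgorithmicPrediction

/-!
The chain rule for the Kullback-Leibler divergence turns the sum of the expected one-step
divergences after `x` into the divergence of the distributions of the next `n` symbols
(`blockDivergence_eq_sum`), and every other deviation is at most the one-step divergence, by
inequalities of Pinsker type (`IsDeviation.nonneg_and_le_klDivergence`). So the first bound follows
(`summable_expectedDeviation`) once `μ(z|x) ≤ B * M(z|x)` with
`log₂ B = K_*(μ|x*) + K(⌈d_μ(x)⌉) + O(1)`, and this is needed only for all sufficiently long `z`.

With `e = ⌈d_μ(x)⌉` one has `2 ^ (e - 1) * μ(x) < M(x) ≤ 2 ^ e * μ(x)`. Hence it suffices to find one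
enumerable semimeasure `R`, independent of `μ` and `x`, with
`2 ^ (-K_*(μ|x*) - K(e)) * 2 ^ (e - 1) * μ(xz) ≤ R(xz)`: it occurs in the mixture `M`. This is
`dominatingSemimeasure`. For each program `q` of an integer `e` and each halting pair `(p, y)` of `W`
with output `T`, one continues to read symbols beyond `y` until a prefix `v` of what has been read is
recognized to satisfy `2 ^ (e - 1) * ν T v ≤ M v`, and from there on adds
`2 ^ (-ℓ(q) - ℓ(p)) * 2 ^ (e - 1) * ν T` to `R`. For fixed `(q, p, y)` the added mass is at most
`2 ^ (-ℓ(q) - ℓ(p)) * M(y)` (`tsum_stopsAt_le`), and the Kraft inequalities for prefix machines and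
for twice prefix machines (`PrefixMachine.tsum_outputs_le`, `TwicePrefixMachine.tsum_outputs_le`)
bound the sum of these by `1`.

The condition `2 ^ (e - 1) * ν T v ≤ M v` is not recursively enumerable, because both sides are only
approximated from below. But `ν T v` may be replaced by `1` minus the mass of the other strings of
the same length, which is an upper bound for every semimeasure and the exact value for a measure
(`LargeDeficiency`). That `x` itself is recognized takes some number of steps, and this is why the
lower bound on `R` is obtained for long continuations only.

The second bound comes from the twice prefix machine `PrefixMachine.twiceMachine`, which computes a
length `i` from a header of its program, reads `i` symbols of the condition, and runs `U` on the
rest of the program with these symbols as condition.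
-/

namespace AlgorithmicPrediction
open scoped ENNReal

/-! ### Recursively enumerable predicates -/

section RecursivelyEnumerable

variable {α : Type*} {β : Type*} [Primcodable α] [Primcodable β]

/-- A recursively enumerable predicate is the increasing union of uniformly computable stages. -/
theorem rePred_exists_stage {p : α → Prop} (hp : REPred p) :
    ∃ d : α → ℕ → Bool, Computable₂ d ∧ (∀ a s t, s ≤ t → d a s = true → d a t = true) ∧
      ∀ a, p a ↔ ∃ s, d a s = true := by
  obtain ⟨c, hc⟩ := Nat.Partrec.Code.exists_code.1 hp
  refine ⟨fun a s => (Nat.Partrec.Code.evaln s c (Encodable.encode a)).isSome, ?_, ?_, ?_⟩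
  · have h : Primrec fun q : α × ℕ => Nat.Partrec.Code.evaln q.2 c (Encodable.encode q.1) :=
      Nat.Partrec.Code.primrec_evaln.comp
        (Primrec.pair (Primrec.pair Primrec.snd (Primrec.const c))
          (Primrec.encode.comp Primrec.fst))
    exact (Primrec.option_isSome.comp h).to_comp
  · intro a s t hst h
    obtain ⟨x, hx⟩ := Option.isSome_iff_exists.1 h
    exact Option.isSome_iff_exists.2 ⟨x, Nat.Partrec.Code.evaln_mono hst hx⟩
  · intro a
    have h1 : p a ↔ ∃ x, x ∈ Nat.Partrec.Code.eval c (Encodable.encode a) := by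
      rw [hc]
      simp [Part.assert]
    rw [h1]
    constructor
    · rintro ⟨x, hx⟩
      obtain ⟨s, hs⟩ := Nat.Partrec.Code.evaln_complete.1 hx
      exact ⟨s, Option.isSome_iff_exists.2 ⟨x, hs⟩⟩
    · rintro ⟨s, hs⟩
      obtain ⟨x, hx⟩ := Option.isSome_iff_exists.1 hs
      exact ⟨x, Nat.Partrec.Code.evaln_sound hx⟩

theorem rePred_of_exists_stage {d : α → ℕ → Bool} (hd : Computable₂ d) :
    REPred fun a => ∃ s, d a s = true := by
  refine (Partrec.rfind (p := fun a s => Part.some (d a s)) hd.partrec₂).dom_re.of_eq fun a => ?_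
  refine Nat.rfind_dom.trans ?_
  constructor
  · rintro ⟨n, hn, -⟩
    exact ⟨n, (Part.mem_some_iff.1 hn).symm⟩
  · rintro ⟨n, hn⟩
    exact ⟨n, by simp [hn], fun _ => trivial⟩

theorem rePred_comp {p : β → Prop} (hp : REPred p) {f : α → β} (hf : Computable f) :
    REPred fun a => p (f a) :=
  Partrec.comp hp hf

theorem rePred_and {p q : α → Prop} (hp : REPred p) (hq : REPred q) :
    REPred fun a => p a ∧ q a := by
  have h : Partrec fun a => (Part.assert (p a) fun _ => Part.some ()).bind
      fun _ => Part.assert (q a) fun _ => Part.some () :=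
    Partrec.bind hp (Partrec.comp (f := fun a => Part.assert (q a) fun _ => Part.some ()) hq
      Computable.fst)
  refine h.dom_re.of_eq fun a => ?_
  simp [Part.assert]

theorem rePred_mem {f : α →. β} (hf : Partrec f) {y : α → β} (hy : Computable y) :
    REPred fun a => y a ∈ f a := by
  classical
  have hb : Computable₂ fun (a : α) (b : β) => decide (y a = b) :=
    (Primrec.eq (α := β)).decide.to_comp.comp (hy.comp Computable.fst) Computable.snd
  have h : Partrec fun a => (f a).bind fun b =>
      ((if decide (y a = b) then some () else none : Option Unit) : Part Unit) := by
    refine Partrec.bind hf (Computable.ofOption ?_)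
    exact (Computable.cond hb (Computable.const (some ())) (Computable.const none)).of_eq
      fun q => by cases h : decide (y q.1 = q.2) <;> simp_all
  refine h.dom_re.of_eq fun a => ?_
  rw [Part.dom_iff_mem]
  simp only [Part.mem_bind_iff]
  constructor
  · rintro ⟨_, b, hb, h⟩
    by_cases hyb : y a = b
    · exact hyb ▸ hb
    · simp [hyb] at h
  · intro h
    exact ⟨(), y a, h, by simp⟩

theorem computable_natPow {f g : α → ℕ} (hf : Computable f) (hg : Computable g) :
    Computable fun a => f a ^ g a := by
  have h : Primrec₂ ((· ^ ·) : ℕ → ℕ → ℕ) := Primrec₂.unpaired'.1 Nat.Primrec.pow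
  exact h.to_comp.comp hf hg

end RecursivelyEnumerable

/-! ### Lower semicomputable functions -/

section LowerSemicomputable

variable {α : Type*} {β : Type*} [Primcodable α] [Primcodable β]

/-- A function with values in `[0, ∞]` is lower semicomputable if it is the supremum of a computable
increasing sequence of dyadic rationals, the `s`-th of which has denominator `2 ^ s`. The condition
`2 * g a s ≤ g a (s + 1)` says that the sequence `g a s / 2 ^ s` increases. -/
def LowerSemicomputable (f : α → ℝ≥0∞) : Prop :=
  ∃ g : α → ℕ → ℕ, Computable₂ g ∧ (∀ a s, 2 * g a s ≤ g a (s + 1)) ∧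
    ∀ a, f a = ⨆ s, (2⁻¹ : ℝ≥0∞) ^ s * g a s

theorem two_mul_inv_two_pow_succ (s : ℕ) : 2 * (2⁻¹ : ℝ≥0∞) ^ (s + 1) = 2⁻¹ ^ s := by
  rw [pow_succ, mul_comm, mul_assoc, ENNReal.inv_mul_cancel (by simp) (by simp), mul_one]

theorem two_pow_mul_inv_two_pow (s : ℕ) : (2 : ℝ≥0∞) ^ s * 2⁻¹ ^ s = 1 := by
  rw [← mul_pow, ENNReal.mul_inv_cancel (by simp) (by simp), one_pow]

theorem monotone_inv_two_pow_mul {g : ℕ → ℕ} (hg : ∀ s, 2 * g s ≤ g (s + 1)) :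
    Monotone fun s => (2⁻¹ : ℝ≥0∞) ^ s * g s := by
  refine monotone_nat_of_le_succ fun s => ?_
  rw [← two_mul_inv_two_pow_succ, mul_comm 2, mul_assoc]
  gcongr
  exact_mod_cast hg s

theorem LowerSemicomputable.comp {f : β → ℝ≥0∞} (hf : LowerSemicomputable f) {h : α → β}
    (hh : Computable h) : LowerSemicomputable fun a => f (h a) := by
  obtain ⟨g, hg, hm, hs⟩ := hf
  exact ⟨fun a => g (h a), hg.comp (hh.comp Computable.fst) Computable.snd,
    fun a => hm (h a), fun a => hs (h a)⟩

theorem LowerSemicomputable.of_eq {f g : α → ℝ≥0∞} (hf : LowerSemicomputable f)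
    (h : ∀ a, f a = g a) : LowerSemicomputable g := by
  rwa [← funext h]

theorem LowerSemicomputable.guard {f : α → ℝ≥0∞} (hf : LowerSemicomputable f) {p : α → Prop}
    [DecidablePred p] (hp : REPred p) : LowerSemicomputable fun a => if p a then f a else 0 := by
  obtain ⟨g, hg, hm, hs⟩ := hf
  obtain ⟨d, hd, hdm, hds⟩ := rePred_exists_stage hp
  refine ⟨fun a s => bif d a s then g a s else 0,
    Computable.cond hd hg (Computable.const 0), fun a s => ?_, fun a => ?_⟩
  · beta_reduce
    cases h : d a s
    · simp
    · simpa [hdm a s (s + 1) (by omega) h] using hm a s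
  · beta_reduce
    have hmono := monotone_inv_two_pow_mul (hm a)
    by_cases hpa : p a
    · obtain ⟨t, ht⟩ := (hds a).1 hpa
      rw [if_pos hpa, hs]
      apply le_antisymm
      · refine iSup_le fun s => le_iSup_of_le (max s t) ?_
        rw [hdm a t _ (le_max_right s t) ht]
        exact hmono (le_max_left s t)
      · refine iSup_mono fun s => ?_
        cases d a s <;> simp
    · have h0 : ∀ s, d a s = false := fun s => by
        by_contra h
        exact hpa ((hds a).2 ⟨s, by simpa using h⟩)
      simp [hpa, h0]

theorem LowerSemicomputable.two_pow_mul {f : α → ℝ≥0∞} (hf : LowerSemicomputable f) {m : α → ℕ}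
    (hm : Computable m) : LowerSemicomputable fun a => 2 ^ m a * f a := by
  obtain ⟨g, hg, hgm, hs⟩ := hf
  refine ⟨fun a s => 2 ^ m a * g a s, Primrec.nat_mul.to_comp.comp
    (computable_natPow (Computable.const 2) (hm.comp Computable.fst)) hg, fun a s => ?_,
    fun a => ?_⟩
  · have := Nat.mul_le_mul_left (2 ^ m a) (hgm a s)
    dsimp only
    linarith
  · beta_reduce
    rw [hs, ENNReal.mul_iSup]
    refine iSup_congr fun s => ?_
    push_cast
    ring

theorem LowerSemicomputable.inv_two_pow_mul {f : α → ℝ≥0∞} (hf : LowerSemicomputable f)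
    {m : α → ℕ} (hm : Computable m) : LowerSemicomputable fun a => 2⁻¹ ^ m a * f a := by
  obtain ⟨g, hg, hgm, hs⟩ := hf
  have hlt : Computable fun q : α × ℕ => decide (q.2 < m q.1) :=
    Primrec.nat_lt.decide.to_comp.comp Computable.snd (hm.comp Computable.fst)
  have hsub : Computable fun q : α × ℕ => q.2 - m q.1 :=
    Primrec.nat_sub.to_comp.comp Computable.snd (hm.comp Computable.fst)
  refine ⟨fun a s => bif decide (s < m a) then 0 else g a (s - m a),
    Computable.cond hlt (Computable.const 0) (hg.comp Computable.fst hsub), fun a s => ?_,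
    fun a => ?_⟩
  · beta_reduce
    by_cases h : s < m a
    · simp [h]
    · have h' : ¬ s + 1 < m a := by omega
      simp only [h, h', decide_false, cond_false]
      rw [show s + 1 - m a = s - m a + 1 by omega]
      exact hgm a _
  · beta_reduce
    rw [hs, ENNReal.mul_iSup]
    apply le_antisymm
    · refine iSup_le fun s => le_iSup_of_le (s + m a) ?_
      simp [pow_add, mul_left_comm, mul_assoc]
    · refine iSup_le fun s => ?_
      by_cases h : s < m a
      · simp [h]
      · refine le_iSup_of_le (s - m a) ?_
        simp only [h, decide_false, cond_false]
        rw [← mul_assoc, ← pow_add, Nat.add_sub_cancel' (by omega)]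

theorem LowerSemicomputable.add {f₁ f₂ : α → ℝ≥0∞} (h₁ : LowerSemicomputable f₁)
    (h₂ : LowerSemicomputable f₂) : LowerSemicomputable fun a => f₁ a + f₂ a := by
  obtain ⟨g₁, hg₁, hm₁, hs₁⟩ := h₁
  obtain ⟨g₂, hg₂, hm₂, hs₂⟩ := h₂
  refine ⟨fun a s => g₁ a s + g₂ a s, Primrec.nat_add.to_comp.comp hg₁ hg₂,
    fun a s => by linarith [hm₁ a s, hm₂ a s], fun a => ?_⟩
  beta_reduce
  rw [hs₁, hs₂, ENNReal.iSup_add_iSup_of_monotone (monotone_inv_two_pow_mul (hm₁ a))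
    (monotone_inv_two_pow_mul (hm₂ a))]
  refine iSup_congr fun s => ?_
  push_cast
  ring

theorem LowerSemicomputable.tsum_nat {F : α → ℕ → ℝ≥0∞}
    (hF : LowerSemicomputable fun q : α × ℕ => F q.1 q.2) :
    LowerSemicomputable fun a => ∑' i, F a i := by
  obtain ⟨g, hg, hgm, hs⟩ := hF
  -- The approximation with denominator `2 ^ s` sums the first `s` terms to that precision.
  let G : α → ℕ → ℕ := fun a s => Nat.rec 0 (fun i acc => acc + g (a, i) s) s
  have hG : ∀ a s, G a s = ∑ i ∈ Finset.range s, g (a, i) s := by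
    intro a s
    have : ∀ n, (Nat.rec 0 (fun i acc => acc + g (a, i) s) n : ℕ)
        = ∑ i ∈ Finset.range n, g (a, i) s := by
      intro n
      induction n with
      | zero => simp
      | succ n ih => rw [Finset.sum_range_succ, ← ih]
    exact this s
  refine ⟨G, ?_, fun a s => ?_, fun a => ?_⟩
  · have hstep : Computable₂ fun (q : α × ℕ) (r : ℕ × ℕ) => r.2 + g (q.1, r.1) q.2 :=
      Primrec.nat_add.to_comp.comp (Computable.snd.comp Computable.snd)
        (hg.comp (Computable.pair (Computable.fst.comp Computable.fst)
          (Computable.fst.comp Computable.snd)) (Computable.snd.comp Computable.fst))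
    exact Computable.nat_rec (Computable.snd (α := α) (β := ℕ)) (Computable.const 0) hstep
  · rw [hG a s, hG a (s + 1), Finset.mul_sum, Finset.sum_range_succ]
    exact le_add_right (Finset.sum_le_sum fun i _ => hgm (a, i) s)
  · have hmono : ∀ i, Monotone fun s => (2⁻¹ : ℝ≥0∞) ^ s * g (a, i) s :=
      fun i => monotone_inv_two_pow_mul (hgm (a, i))
    simp only [ENNReal.tsum_eq_iSup_nat, hG]
    have h1 : ∀ n, ∑ i ∈ Finset.range n, F a i
        = ⨆ s, ∑ i ∈ Finset.range n, (2⁻¹ : ℝ≥0∞) ^ s * g (a, i) s := by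
      intro n
      rw [← ENNReal.finsetSum_iSup_of_monotone hmono]
      exact Finset.sum_congr rfl fun i _ => hs (a, i)
    simp only [h1, Nat.cast_sum, Finset.mul_sum]
    apply le_antisymm
    · refine iSup_le fun n => iSup_le fun s => le_iSup_of_le (max n s) ?_
      calc _ ≤ ∑ i ∈ Finset.range n, (2⁻¹ : ℝ≥0∞) ^ (max n s) * g (a, i) (max n s) :=
            Finset.sum_le_sum fun i _ => hmono i (le_max_right n s)
        _ ≤ _ := Finset.sum_le_sum_of_subset (by simp)
    · exact iSup_le fun s => le_iSup_of_le s (le_iSup_of_le s le_rfl)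

theorem LowerSemicomputable.tsum {F : α → β → ℝ≥0∞}
    (hF : LowerSemicomputable fun q : α × β => F q.1 q.2) :
    LowerSemicomputable fun a => ∑' b, F a b := by
  -- Indices that are not codes contribute zero, and `decode₂` counts no element of `β` twice.
  let F' : α → ℕ → ℝ≥0∞ := fun a i => (Encodable.decode₂ β i).elim 0 (F a)
  have hF' : LowerSemicomputable fun q : α × ℕ => F' q.1 q.2 := by
    obtain ⟨g, hg, hgm, hs⟩ := hF
    refine ⟨fun q s => Option.casesOn (Encodable.decode₂ β q.2) 0 fun b => g (q.1, b) s, ?_, ?_, ?_⟩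
    · refine Computable.option_casesOn
        (Primrec.decode₂.to_comp.comp (Computable.snd.comp Computable.fst)) (Computable.const 0) ?_
      exact hg.comp (Computable.pair
        (Computable.fst.comp (Computable.fst.comp Computable.fst)) Computable.snd)
        (Computable.snd.comp Computable.fst)
    · rintro ⟨a, i⟩ s
      dsimp only
      cases h : Encodable.decode₂ β i with
      | none => simp
      | some b => exact hgm (a, b) s
    · rintro ⟨a, i⟩
      simp only [F']
      cases h : Encodable.decode₂ β i with
      | none => simp
      | some b => exact hs (a, b)
  refine hF'.tsum_nat.of_eq fun a => ?_
  rw [← (Encodable.encode_injective (α := β)).tsum_eq]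
  · simp [F']
  · intro i hi
    simp only [F', Function.mem_support] at hi
    cases h : Encodable.decode₂ β i with
    | none => simp [h] at hi
    | some b => exact ⟨b, Encodable.mem_decode₂.1 h⟩

theorem LowerSemicomputable.iSup_nat {F : α → ℕ → ℝ≥0∞}
    (hF : LowerSemicomputable fun q : α × ℕ => F q.1 q.2) :
    LowerSemicomputable fun a => ⨆ i, F a i := by
  obtain ⟨g, hg, hgm, hs⟩ := hF
  let G : α → ℕ → ℕ := fun a s => Nat.rec 0 (fun i acc => max acc (g (a, i) s)) s
  have hG : ∀ a s, G a s = (Finset.range s).sup fun i => g (a, i) s := by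
    intro a s
    have : ∀ n, (Nat.rec 0 (fun i acc => max acc (g (a, i) s)) n : ℕ)
        = (Finset.range n).sup fun i => g (a, i) s := by
      intro n
      induction n with
      | zero => simp
      | succ n ih => rw [Finset.range_add_one, Finset.sup_insert, ← ih]; exact max_comm _ _
    exact this s
  refine ⟨G, ?_, fun a s => ?_, fun a => ?_⟩
  · have hstep : Computable₂ fun (q : α × ℕ) (r : ℕ × ℕ) => max r.2 (g (q.1, r.1) q.2) :=
      Primrec.nat_max.to_comp.comp (Computable.snd.comp Computable.snd)
        (hg.comp (Computable.pair (Computable.fst.comp Computable.fst)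
          (Computable.fst.comp Computable.snd)) (Computable.snd.comp Computable.fst))
    exact Computable.nat_rec (Computable.snd (α := α) (β := ℕ)) (Computable.const 0) hstep
  · have h : (Finset.range s).sup (fun i => g (a, i) s) ≤ G a (s + 1) / 2 := by
      refine Finset.sup_le fun i hi => ?_
      rw [Nat.le_div_iff_mul_le (by norm_num), mul_comm, hG a (s + 1)]
      exact (hgm (a, i) s).trans (Finset.le_sup (f := fun i => g (a, i) (s + 1))
        (Finset.mem_range.2 ((Finset.mem_range.1 hi).trans (Nat.lt_succ_self s))))
    rw [← hG] at h
    omega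
  · apply le_antisymm
    · refine iSup_le fun i => (hs (a, i)).trans_le (iSup_le fun s => ?_)
      refine le_iSup_of_le (max (i + 1) s) ?_
      refine (monotone_inv_two_pow_mul (hgm (a, i)) (le_max_right (i + 1) s)).trans ?_
      dsimp only
      gcongr
      rw [hG]
      exact Finset.le_sup (f := fun j => g (a, j) (max (i + 1) s)) (by simp)
    · refine iSup_le fun s => ?_
      rw [hG]
      rcases Finset.eq_empty_or_nonempty (Finset.range s) with h | h
      · simp [h]
      · obtain ⟨i, -, hi⟩ := Finset.exists_mem_eq_sup _ h fun i => g (a, i) s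
        rw [hi]
        refine le_iSup_of_le i ?_
        exact (le_iSup (fun s => (2⁻¹ : ℝ≥0∞) ^ s * g (a, i) s) s).trans_eq (hs (a, i)).symm

theorem lowerSemicomputable_natCast_div {k n : α → ℕ} (hk : Computable k) (hn : Computable n) :
    LowerSemicomputable fun a => (k a : ℝ≥0∞) / (n a + 1) := by
  refine ⟨fun a s => 2 ^ s * k a / (n a + 1), ?_, fun a s => ?_, fun a => ?_⟩
  · exact Primrec.nat_div.to_comp.comp (Primrec.nat_mul.to_comp.comp
      (computable_natPow (Computable.const 2) Computable.snd) (hk.comp Computable.fst))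
      (Computable.succ.comp (hn.comp Computable.fst))
  · beta_reduce
    rw [pow_succ, mul_comm (2 ^ s) 2, mul_assoc]
    exact Nat.mul_div_le_mul_div_assoc _ _ _
  · beta_reduce
    have h0 : ((n a : ℝ≥0∞) + 1) ≠ 0 := by simp
    have ht : ((n a : ℝ≥0∞) + 1) ≠ ⊤ := by simp
    apply le_antisymm
    · refine ENNReal.le_of_forall_pos_le_add fun ε hε _ => ?_
      obtain ⟨s, hs⟩ := ENNReal.exists_inv_two_pow_lt (a := (ε : ℝ≥0∞)) (by simpa using hε.ne')
      have h1 : (2 : ℝ≥0∞) ^ s * k a ≤ ((2 ^ s * k a / (n a + 1) : ℕ) + 1) * (n a + 1) := by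
        exact_mod_cast (Nat.lt_div_mul_add (a := 2 ^ s * k a) (b := n a + 1) (by omega)).le.trans
          (by rw [add_mul, one_mul])
      calc (k a : ℝ≥0∞) / (n a + 1)
          ≤ 2⁻¹ ^ s * ((2 ^ s * k a / (n a + 1) : ℕ) + 1) := by
            rw [ENNReal.div_le_iff h0 ht, mul_assoc]
            calc (k a : ℝ≥0∞) = 2⁻¹ ^ s * (2 ^ s * k a) := by
                  rw [← mul_assoc, mul_comm (2⁻¹ ^ s), two_pow_mul_inv_two_pow, one_mul]
              _ ≤ _ := by gcongr
        _ = 2⁻¹ ^ s * (2 ^ s * k a / (n a + 1) : ℕ) + 2⁻¹ ^ s := by rw [mul_add, mul_one]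
        _ ≤ _ := by
          gcongr
          exact le_iSup (fun s => (2⁻¹ : ℝ≥0∞) ^ s * (2 ^ s * k a / (n a + 1) : ℕ)) s
    · refine iSup_le fun s => ?_
      rw [ENNReal.le_div_iff_mul_le (Or.inl h0) (Or.inl ht), mul_assoc]
      calc (2⁻¹ : ℝ≥0∞) ^ s * (((2 ^ s * k a / (n a + 1) : ℕ) : ℝ≥0∞) * (n a + 1))
          ≤ 2⁻¹ ^ s * (2 ^ s * k a) := by
            refine mul_le_mul_right ?_ _
            exact_mod_cast Nat.div_mul_le_self (2 ^ s * k a) (n a + 1)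
        _ = k a := by rw [← mul_assoc, mul_comm (2⁻¹ ^ s), two_pow_mul_inv_two_pow, one_mul]

/-- A function is lower semicomputable if its strict subgraph over the nonnegative rationals is
recursively enumerable. Conversely, see `LowerSemicomputable.rePred_lt`. -/
theorem lowerSemicomputable_of_rePred {f : α → ℝ≥0∞}
    (h : REPred fun q : α × ℕ × ℕ => (q.2.1 : ℝ≥0∞) / (q.2.2 + 1) < f q.1) :
    LowerSemicomputable f := by
  classical
  have hq : Computable fun q : α × ℕ => ((q.1, q.2.unpair) : α × ℕ × ℕ) :=
    Computable.pair Computable.fst (Computable.unpair.comp Computable.snd)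
  have h1 := (lowerSemicomputable_natCast_div
    (Computable.fst.comp (Computable.unpair.comp (Computable.snd (α := α))))
    (Computable.snd.comp (Computable.unpair.comp (Computable.snd (α := α))))).guard
    (rePred_comp h hq)
  refine (LowerSemicomputable.iSup_nat (F := fun a m =>
    if (m.unpair.1 : ℝ≥0∞) / (m.unpair.2 + 1) < f a then (m.unpair.1 : ℝ≥0∞) / (m.unpair.2 + 1)
    else 0) h1).of_eq fun a => ?_
  apply le_antisymm
  · refine iSup_le fun m => ?_
    split_ifs with hm
    · exact hm.le
    · simp
  · refine le_of_forall_lt fun c hc => ?_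
    obtain ⟨q, hq0, hcq, hqf⟩ := ENNReal.lt_iff_exists_rat_btwn.1 hc
    have hqe : ((Real.toNNReal q : NNReal) : ℝ≥0∞)
        = ((q.num.toNat : ℕ) : ℝ≥0∞) / (((q.den - 1 : ℕ) : ℝ≥0∞) + 1) := by
      have hd : (((q.den - 1 : ℕ) : ℝ≥0∞) + 1) = (q.den : ℕ) := by
        exact_mod_cast Nat.sub_add_cancel q.den_pos
      rw [hd]
      have : (q : ℝ) = (q.num.toNat : ℕ) / (q.den : ℕ) := by
        have h2 : ((q.num.toNat : ℕ) : ℤ) = q.num := Int.toNat_of_nonneg (Rat.num_nonneg.2 hq0)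
        have h3 : ((q.num.toNat : ℕ) : ℝ) = (q.num : ℝ) := by exact_mod_cast h2
        rw [h3]
        exact_mod_cast (Rat.num_div_den q).symm
      rw [this]
      change ENNReal.ofReal _ = _
      rw [ENNReal.ofReal_div_of_pos (by exact_mod_cast q.den_pos)]
      simp
    rw [lt_iSup_iff]
    refine ⟨Nat.pair q.num.toNat (q.den - 1), ?_⟩
    rw [Nat.unpair_pair, ← hqe, if_pos hqf]
    exact hcq

theorem LowerSemicomputable.rePred_lt {f : α → ℝ≥0∞} (hf : LowerSemicomputable f) {k n : α → ℕ}
    (hk : Computable k) (hn : Computable n) :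
    REPred fun a => (k a : ℝ≥0∞) / (n a + 1) < f a := by
  obtain ⟨g, hg, hgm, hs⟩ := hf
  have h : Computable₂ fun (a : α) (s : ℕ) => decide (2 ^ s * k a < g a s * (n a + 1)) :=
    Primrec.nat_lt.decide.to_comp.comp (Primrec.nat_mul.to_comp.comp
      (computable_natPow (Computable.const 2) Computable.snd) (hk.comp Computable.fst))
      (Primrec.nat_mul.to_comp.comp hg (Computable.succ.comp (hn.comp Computable.fst)))
  refine (rePred_of_exists_stage h).of_eq fun a => ?_
  rw [hs, lt_iSup_iff]
  refine exists_congr fun s => ?_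
  have h0 : ((n a : ℝ≥0∞) + 1) ≠ 0 := by simp
  have ht : ((n a : ℝ≥0∞) + 1) ≠ ⊤ := by simp
  rw [decide_eq_true_iff, ENNReal.div_lt_iff (Or.inl h0) (Or.inl ht), mul_assoc, ← ENNReal.inv_pow,
    ← ENNReal.div_eq_inv_mul, ENNReal.lt_div_iff_mul_lt (by simp) (by simp), mul_comm (k a : ℝ≥0∞)]
  norm_cast

end LowerSemicomputable

/-! ### The halting computations are recursively enumerable -/

section Halting

variable {X : Type u} [Primcodable X]

theorem PrefixMachine.rePred_outputs (U : PrefixMachine X) :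
    REPred fun q : List Bool × List X × ℕ => U.Outputs q.1 q.2.1 q.2.2 := by
  -- `p` is read exactly if `ℓ(p)` is the first length after which `U` does not request a bit.
  have htake : Computable fun q : (List Bool × List X × ℕ) × ℕ => (q.1.2.1, q.1.1.take q.2) :=
    Computable.pair (Computable.fst.comp (Computable.snd.comp Computable.fst))
      (Primrec.list_take.to_comp.comp Computable.snd (Computable.fst.comp Computable.fst))
  have h1 : Partrec₂ fun (q : List Bool × List X × ℕ) (k : ℕ) =>
      (U.next (q.2.1, q.1.take k)).map Option.isSome :=
    Partrec.map (U.partrec.comp htake) (Primrec.option_isSome.to_comp.comp Computable.snd)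
  have h2 := rePred_mem (Partrec.rfind h1)
    (Computable.list_length.comp (Computable.fst (α := List Bool) (β := List X × ℕ)))
  have h3 := rePred_mem (U.partrec.comp (Computable.pair
      (Computable.fst.comp (Computable.snd (α := List Bool) (β := List X × ℕ))) Computable.fst))
    (Computable.option_some.comp (Computable.snd.comp Computable.snd))
  refine (rePred_and h2 h3).of_eq fun q => ?_
  obtain ⟨p, x, y⟩ := q
  refine and_congr_left fun hy => ?_
  refine Nat.mem_rfind.trans ?_
  simp only [List.take_length, Part.mem_map_iff]
  constructor
  · rintro ⟨-, h⟩ k hk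
    obtain ⟨o, ho, hos⟩ := h hk
    rw [Option.isSome_eq_false_iff, Option.isNone_iff_eq_none] at hos
    exact hos ▸ ho
  · intro h
    exact ⟨⟨_, hy, rfl⟩, fun {k} hk => ⟨none, h k hk, rfl⟩⟩

namespace TwicePrefixMachine

/-- The numbers of symbols read from the two tapes after one more step, if `r` is what the machine
does next. -/
def advance (s : ℕ × ℕ) : Bool ⊕ ℕ → ℕ × ℕ
  | Sum.inl false => (s.1 + 1, s.2)
  | Sum.inl true => (s.1, s.2 + 1)
  | Sum.inr _ => s

/-- The numbers of symbols that the machine has read from its tapes after `n` steps, where the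
tapes contain `q.1` and `q.2`. (The value is not meaningful once a tape is exhausted.) -/
def headPositions (W : TwicePrefixMachine X) (q : List Bool × List X) (n : ℕ) : Part (ℕ × ℕ) :=
  Nat.rec (Part.some (0, 0))
    (fun _ r => r.bind fun s => (W.next (q.1.take s.1, q.2.take s.2)).map (advance s)) n

theorem headPositions_succ (W : TwicePrefixMachine X) (q : List Bool × List X) (n : ℕ) :
    W.headPositions q (n + 1) = (W.headPositions q n).bind
      fun s => (W.next (q.1.take s.1, q.2.take s.2)).map (advance s) := rfl

theorem computable_advance : Computable₂ advance := by
  refine (Computable.sumCasesOn (f := fun q : (ℕ × ℕ) × (Bool ⊕ ℕ) => q.2)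
    (g := fun q b => bif b then (q.1.1, q.1.2 + 1) else (q.1.1 + 1, q.1.2)) (h := fun q _ => q.1)
    Computable.snd ?_ (Computable.fst.comp Computable.fst)).of_eq ?_
  · exact Computable.cond Computable.snd
      (Computable.pair (Computable.fst.comp (Computable.fst.comp Computable.fst))
        (Computable.succ.comp (Computable.snd.comp (Computable.fst.comp Computable.fst))))
      (Computable.pair
        (Computable.succ.comp (Computable.fst.comp (Computable.fst.comp Computable.fst)))
        (Computable.snd.comp (Computable.fst.comp Computable.fst)))
  · rintro ⟨s, (_ | _) | y⟩ <;> rfl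

theorem partrec_headPositions (W : TwicePrefixMachine X) : Partrec₂ W.headPositions := by
  have h : Partrec₂ fun (q : (List Bool × List X) × ℕ) (r : ℕ × (ℕ × ℕ)) =>
      (W.next (q.1.1.take r.2.1, q.1.2.take r.2.2)).map (advance r.2) := by
    refine Partrec.map (W.partrec.comp (Computable.pair ?_ ?_)) ?_
    · exact Primrec.list_take.to_comp.comp
        (Computable.fst.comp (Computable.snd.comp Computable.snd))
        (Computable.fst.comp (Computable.fst.comp Computable.fst))
    · exact Primrec.list_take.to_comp.comp
        (Computable.snd.comp (Computable.snd.comp Computable.snd))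
        (Computable.snd.comp (Computable.fst.comp Computable.fst))
    · exact computable_advance.comp
        (Computable.snd.comp (Computable.snd.comp Computable.fst)) Computable.snd
  exact Partrec.nat_rec (Computable.snd (α := List Bool × List X))
    (Partrec.some.comp (Computable.const ((0, 0) : ℕ × ℕ))) h

/-- If the two heads have together moved `n` times in `n` steps and are still on the tapes, then the
machine has not halted, and each of the steps was a step of `Reads`. -/
theorem reads_of_mem_headPositions (W : TwicePrefixMachine X) (q : List Bool × List X) (n : ℕ) :
    ∀ s ∈ W.headPositions q n, s.1 + s.2 ≤ n ∧
      (s.1 ≤ q.1.length → s.2 ≤ q.2.length → s.1 + s.2 = n →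
        W.Reads (q.1.take s.1) (q.2.take s.2)) := by
  induction n with
  | zero =>
    intro s hs
    obtain rfl : s = (0, 0) := Part.mem_some_iff.1 hs
    simpa using Reads.start
  | succ n ih =>
    intro s hs
    rw [headPositions_succ] at hs
    obtain ⟨t, ht, hs⟩ := Part.mem_bind_iff.1 hs
    obtain ⟨r, hr, rfl⟩ := (Part.mem_map_iff _).1 hs
    obtain ⟨h1, h2⟩ := ih t ht
    match r, hr with
    | Sum.inl false, hr =>
      refine ⟨by simp only [advance]; omega, fun ha hb hc => ?_⟩
      simp only [advance] at ha hb hc ⊢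
      rw [List.take_add_one, List.getElem?_eq_getElem (by omega)]
      exact Reads.readProgram _ (h2 (by omega) hb (by omega)) hr
    | Sum.inl true, hr =>
      refine ⟨by simp only [advance]; omega, fun ha hb hc => ?_⟩
      simp only [advance] at ha hb hc ⊢
      rw [List.take_add_one, List.getElem?_eq_getElem (by omega)]
      exact Reads.readCondition _ (h2 ha (by omega) (by omega)) hr
    | Sum.inr y, hr =>
      simp only [advance]
      exact ⟨by omega, fun _ _ _ => by omega⟩

theorem Reads.mem_headPositions {W : TwicePrefixMachine X} {p : List Bool} {x : List X}
    (h : W.Reads p x) {q : List Bool × List X} (hp : p <+: q.1) (hx : x <+: q.2) :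
    (p.length, x.length) ∈ W.headPositions q (p.length + x.length) := by
  induction h with
  | start => exact Part.mem_some _
  | @readProgram p x b h hn ih =>
    have hp' : p <+: q.1 := (List.prefix_append _ _).trans hp
    rw [List.length_append, List.length_singleton, add_right_comm, headPositions_succ]
    refine Part.mem_bind (ih hp' hx) ((Part.mem_map_iff _).2 ⟨Sum.inl false, ?_, rfl⟩)
    rwa [← List.prefix_iff_eq_take.1 hp', ← List.prefix_iff_eq_take.1 hx]
  | @readCondition p x a h hn ih =>
    have hx' : x <+: q.2 := (List.prefix_append _ _).trans hx
    rw [List.length_append, List.length_singleton, ← add_assoc, headPositions_succ]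
    refine Part.mem_bind (ih hp hx') ((Part.mem_map_iff _).2 ⟨Sum.inl true, ?_, rfl⟩)
    rwa [← List.prefix_iff_eq_take.1 hp, ← List.prefix_iff_eq_take.1 hx']

theorem rePred_outputs (W : TwicePrefixMachine X) :
    REPred fun q : List Bool × List X × ℕ => W.Outputs q.1 q.2.1 q.2.2 := by
  have hpx : Computable fun q : List Bool × List X × ℕ => (q.1, q.2.1) :=
    Computable.pair Computable.fst (Computable.fst.comp Computable.snd)
  have hl : Computable fun q : List Bool × List X × ℕ => (q.1.length, q.2.1.length) :=
    Computable.pair (Computable.list_length.comp Computable.fst)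
      (Computable.list_length.comp (Computable.fst.comp Computable.snd))
  have h1 := rePred_mem (W.partrec_headPositions.comp hpx
    (Primrec.nat_add.to_comp.comp (Computable.fst.comp hl) (Computable.snd.comp hl))) hl
  have h2 := rePred_mem (W.partrec.comp hpx)
    (Computable.sumInr.comp (Computable.snd.comp Computable.snd))
  refine (rePred_and h1 h2).of_eq fun q => and_congr_left fun _ => ⟨fun h => ?_, fun h => ?_⟩
  · simpa using (W.reads_of_mem_headPositions _ _ _ h).2 le_rfl le_rfl rfl
  · exact h.mem_headPositions (List.prefix_refl _) (List.prefix_refl _)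

end TwicePrefixMachine

end Halting

/-! ### Kraft inequalities -/

section Kraft

open Classical in
/-- The elements of `H` that are reached from `s` in fewer than `n` steps to a child, where a path
ends as soon as it meets `H`. -/
def leavesWithin {σ : Type*} (ch : σ → Finset σ) (H : Set σ) : ℕ → σ → Set σ
  | 0, _ => ∅
  | n + 1, s => if s ∈ H then {s} else ⋃ t ∈ ch s, leavesWithin ch H n t

theorem leavesWithin_mono {σ : Type*} (ch : σ → Finset σ) (H : Set σ) (s : σ) :
    Monotone fun n => leavesWithin ch H n s := by
  refine monotone_nat_of_le_succ fun n => ?_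
  induction n generalizing s with
  | zero => exact Set.empty_subset _
  | succ n ih =>
    rw [leavesWithin, leavesWithin]
    split_ifs
    · exact le_rfl
    · exact Set.iUnion₂_mono fun t _ => ih t

theorem tsum_leavesWithin_le {σ : Type*} {ch : σ → Finset σ} {w : σ → ℝ≥0∞}
    (hw : ∀ s, ∑ t ∈ ch s, w t ≤ w s) (H : Set σ) (n : ℕ) (s : σ) :
    ∑' t : leavesWithin ch H n s, w t ≤ w s := by
  induction n generalizing s with
  | zero => simp [leavesWithin]
  | succ n ih =>
    by_cases h : s ∈ H
    · rw [leavesWithin, if_pos h]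
      simp
    · rw [leavesWithin, if_neg h]
      calc ∑' t : ↑(⋃ t ∈ ch s, leavesWithin ch H n t), w t
          ≤ ∑ t ∈ ch s, ∑' r : leavesWithin ch H n t, w r := ENNReal.tsum_biUnion_le _ _ _
        _ ≤ ∑ t ∈ ch s, w t := Finset.sum_le_sum fun t _ => ih t
        _ ≤ w s := hw s

/-- In a tree on which the weight of a node is at least the total weight of its children, the total
weight of a set of leaves that are reached from the root is at most the weight of the root. -/
theorem tsum_indicator_leaves_le {σ : Type*} {ch : σ → Finset σ} {w : σ → ℝ≥0∞}
    (hw : ∀ s, ∑ t ∈ ch s, w t ≤ w s) {H : Set σ} (hH : ∀ s ∈ H, ch s = ∅) {r : σ}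
    (hr : ∀ s ∈ H, Relation.ReflTransGen (fun s t => t ∈ ch s) r s) :
    ∑' s, H.indicator w s ≤ w r := by
  classical
  have hmem : ∀ s ∈ H, ∃ n, s ∈ leavesWithin ch H n r := by
    intro s hs
    refine Relation.ReflTransGen.head_induction_on (hr s hs)
      ⟨1, by simp [leavesWithin, hs]⟩ fun {a c} hac _ ⟨n, hn⟩ => ⟨n + 1, ?_⟩
    have ha : a ∉ H := fun h => by simp [hH a h] at hac
    simp only [leavesWithin, if_neg ha, Set.mem_iUnion]
    exact ⟨c, hac, hn⟩
  choose! n hn using hmem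
  rw [ENNReal.tsum_eq_iSup_sum]
  refine iSup_le fun F => ?_
  have hF : ∀ s ∈ F, H.indicator w s
      ≤ (leavesWithin ch H (F.sup n) r).indicator w s := by
    intro s hs
    by_cases h : s ∈ H
    · rw [Set.indicator_of_mem h, Set.indicator_of_mem
        (leavesWithin_mono ch H r (Finset.le_sup hs) (hn s h))]
    · simp [h]
  calc ∑ s ∈ F, H.indicator w s
      ≤ ∑ s ∈ F, (leavesWithin ch H (F.sup n) r).indicator w s := Finset.sum_le_sum hF
    _ ≤ ∑' s, (leavesWithin ch H (F.sup n) r).indicator w s := ENNReal.sum_le_tsum F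
    _ = ∑' s : leavesWithin ch H (F.sup n) r, w s := (tsum_subtype _ _).symm
    _ ≤ w r := tsum_leavesWithin_le hw H _ r

theorem sum_image_append_singleton {α : Type*} [Fintype α] [DecidableEq (List α)]
    (φ : List α → ℝ≥0∞) (z : List α) :
    ∑ t ∈ Finset.univ.image (fun a => z ++ [a]), φ t = ∑ a, φ (z ++ [a]) :=
  Finset.sum_image fun a _ b _ h => by simpa using h

/-- The Kraft inequality for a prefix-free set of extensions of a string. -/
theorem tsum_indicator_prefixFree_le {α : Type*} [Fintype α] {φ : List α → ℝ≥0∞}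
    (hφ : ∀ z, ∑ a, φ (z ++ [a]) ≤ φ z) {A : Set (List α)} {x : List α}
    (hx : ∀ z ∈ A, x <+: z) (hA : ∀ z ∈ A, ∀ w ∈ A, z <+: w → z = w) :
    ∑' z, A.indicator φ z ≤ φ x := by
  classical
  refine tsum_indicator_leaves_le
    (ch := fun z => if z ∈ A then ∅ else Finset.univ.image fun a => z ++ [a])
    (fun z => ?_) (fun z hz => if_pos hz) fun z hz => ?_
  · split_ifs
    · simp
    · rw [sum_image_append_singleton]
      exact hφ z
  · have key : ∀ v, x ++ v <+: z → Relation.ReflTransGen (fun s t : List α =>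
        t ∈ (if s ∈ A then ∅ else Finset.univ.image fun a => s ++ [a])) x (x ++ v) := by
      intro v
      induction v using List.reverseRecOn with
      | nil => intro _; simpa using Relation.ReflTransGen.refl
      | append_singleton v a ih =>
        intro hv
        have hv' : x ++ v ++ [a] <+: z := by simpa using hv
        have hz' : x ++ v <+: z := (List.prefix_append _ _).trans hv'
        refine (ih hz').tail ?_
        have hnot : x ++ v ∉ A := fun h => by
          have := hA _ h _ hz hz'
          have hl := hv'.length_le
          rw [← this] at hl
          simp at hl
        rw [if_neg hnot]
        simp
    obtain ⟨v, rfl⟩ := hx z hz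
    exact key v (List.prefix_refl _)

theorem sum_inv_two_pow_length_append (p : List Bool) :
    ∑ b, (2⁻¹ : ℝ≥0∞) ^ (p ++ [b]).length = 2⁻¹ ^ p.length := by
  simp only [List.length_append, List.length_singleton, Finset.sum_const, Finset.card_univ,
    Fintype.card_bool, nsmul_eq_mul, Nat.cast_ofNat]
  exact two_mul_inv_two_pow_succ _

theorem PrefixMachine.Outputs.eq_of_prefix {X : Type u} [Primcodable X] {U : PrefixMachine X}
    {p q : List Bool} {x : List X} {y z : ℕ} (hp : U.Outputs p x y) (hq : U.Outputs q x z)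
    (hpq : p <+: q) : p = q := by
  by_contra hne
  have hlt : p.length < q.length := lt_of_le_of_ne hpq.length_le fun h => hne (hpq.eq_of_length h)
  have h1 := hq.1 _ hlt
  rw [← List.prefix_iff_eq_take.1 hpq] at h1
  exact absurd (Part.mem_unique h1 hp.2) (by simp)

open Classical in
/-- The programs on which a prefix machine halts satisfy the Kraft inequality. -/
theorem PrefixMachine.tsum_outputs_le {X : Type u} [Primcodable X] (U : PrefixMachine X)
    (x : List X) :
    ∑' (p : List Bool) (y : ℕ), (if U.Outputs p x y then (2⁻¹ : ℝ≥0∞) ^ p.length else 0) ≤ 1 := by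
  have h := tsum_indicator_prefixFree_le (x := []) (A := {p | ∃ y, U.Outputs p x y})
    (fun p => (sum_inv_two_pow_length_append p).le) (fun _ _ => List.nil_prefix)
    (fun p ⟨y, hp⟩ q ⟨z, hq⟩ hpq => hp.eq_of_prefix hq hpq)
  refine le_trans (ENNReal.tsum_le_tsum fun p => ?_) (h.trans_eq (by simp))
  by_cases hp : ∃ y, U.Outputs p x y
  · obtain ⟨y, hy⟩ := hp
    rw [tsum_eq_single y, if_pos hy, Set.indicator_of_mem (by exact ⟨y, hy⟩)]
    intro z hz
    refine if_neg fun hz' => hz ?_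
    simpa using Part.mem_unique hz'.2 hy.2
  · have : ∀ y, ¬ U.Outputs p x y := fun y hy => hp ⟨y, hy⟩
    simp [this]

open Classical in
/-- The Kraft inequality for twice prefix machines: if the programs are weighted by `2 ^ (-ℓ(p))`
and the conditions by a semimeasure, then the halting pairs have weight at most that of the pair of
empty strings, although neither the programs nor the conditions need be prefix-free. -/
theorem TwicePrefixMachine.tsum_outputs_le {X : Type u} [Primcodable X] [Fintype X]
    (W : TwicePrefixMachine X) {φ : List X → ℝ≥0∞} (hφ : ∀ z, ∑ a, φ (z ++ [a]) ≤ φ z) :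
    ∑' (p : List Bool) (x : List X) (y : ℕ),
      (if W.Outputs p x y then (2⁻¹ : ℝ≥0∞) ^ p.length * φ x else 0) ≤ φ [] := by
  let ch : List Bool × List X → Finset (List Bool × List X) := fun s =>
    if Sum.inl false ∈ W.next s then Finset.univ.image fun b => (s.1 ++ [b], s.2)
    else if Sum.inl true ∈ W.next s then Finset.univ.image fun a => (s.1, s.2 ++ [a]) else ∅
  have h := tsum_indicator_leaves_le (ch := ch) (r := ([], []))
    (w := fun s => (2⁻¹ : ℝ≥0∞) ^ s.1.length * φ s.2)
    (H := {s | ∃ y, W.Outputs s.1 s.2 y}) ?_ ?_ ?_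
  · rw [← ENNReal.tsum_prod (f := fun p x => ∑' y : ℕ,
      (if W.Outputs p x y then (2⁻¹ : ℝ≥0∞) ^ p.length * φ x else 0))]
    refine le_trans (ENNReal.tsum_le_tsum fun s => ?_) (h.trans_eq (by simp))
    by_cases hp : ∃ y, W.Outputs s.1 s.2 y
    · obtain ⟨y, hy⟩ := hp
      rw [tsum_eq_single y, if_pos hy, Set.indicator_of_mem (by exact ⟨y, hy⟩)]
      intro z hz
      refine if_neg fun hz' => hz ?_
      simpa using Part.mem_unique hz'.2 hy.2
    · have : ∀ y, ¬ W.Outputs s.1 s.2 y := fun y hy => hp ⟨y, hy⟩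
      simp [this]
  · rintro ⟨p, x⟩
    simp only [ch]
    split_ifs
    · rw [Finset.sum_image fun a _ b _ h => by simpa using h]
      dsimp only
      rw [← Finset.sum_mul, sum_inv_two_pow_length_append]
    · rw [Finset.sum_image fun a _ b _ h => by simpa using h]
      dsimp only
      rw [← Finset.mul_sum]
      gcongr
      exact hφ x
    · simp
  · rintro s ⟨y, hy⟩
    have h1 : ∀ b, Sum.inl b ∉ W.next s := fun b hb => by
      simpa using Part.mem_unique hb hy.2
    simp [ch, h1]
  · rintro ⟨p, x⟩ ⟨y, hy⟩
    have hr := hy.1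
    dsimp only at hr
    clear hy
    induction hr with
    | start => exact Relation.ReflTransGen.refl
    | readProgram b _ hn ih => exact ih.tail (by simp [ch, hn])
    | readCondition a _ hn ih =>
      have h1 : Sum.inl false ∉ W.next (_, _) := fun hb => by
        simpa using Part.mem_unique hb hn
      exact ih.tail (by simp [ch, hn, h1])

end Kraft

/-! ### Sums over strings of a given length -/

section Strings

variable {X : Type u} [Fintype X]

theorem sum_ofFn_succ_last {A : Type*} [AddCommMonoid A] (f : List X → A) (n : ℕ) :
    ∑ z : Fin (n + 1) → X, f (List.ofFn z) = ∑ z : Fin n → X, ∑ a, f (List.ofFn z ++ [a]) := by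
  rw [← (Fin.snocEquiv fun _ : Fin (n + 1) => X).sum_comp, Fintype.sum_prod_type,
    Finset.sum_comm]
  refine Finset.sum_congr rfl fun z _ => Finset.sum_congr rfl fun a _ => ?_
  rw [List.ofFn_succ']
  simp [Fin.snocEquiv, List.concat_eq_append]

theorem sum_append_ofFn {A : Type*} [AddCommMonoid A] {μ : List X → A}
    (h : ∀ x, ∑ a, μ (x ++ [a]) = μ x) (n : ℕ) (x : List X) :
    ∑ z : Fin n → X, μ (x ++ List.ofFn z) = μ x := by
  induction n with
  | zero => simp
  | succ n ih =>
    rw [sum_ofFn_succ_last fun z => μ (x ++ z), ← ih]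
    refine Finset.sum_congr rfl fun z _ => ?_
    rw [← h]
    simp

theorem tsum_length_eq (f : List X → ℝ≥0∞) (n : ℕ) :
    ∑' v : List X, (if v.length = n then f v else 0) = ∑ z : Fin n → X, f (List.ofFn z) := by
  rw [← (List.ofFn_injective (α := X) (n := n)).tsum_eq, tsum_fintype]
  · simp
  · intro v hv
    have : v.length = n := by
      by_contra h
      simp [h] at hv
    exact ⟨fun i => v.get (i.cast this.symm), by subst this; simp⟩

theorem tsum_length_le {φ : List X → ℝ≥0∞} (hφ : ∀ z, ∑ a, φ (z ++ [a]) ≤ φ z) (n : ℕ) :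
    ∑' v : List X, (if v.length = n then φ v else 0) ≤ φ [] := by
  have h := tsum_indicator_prefixFree_le hφ (A := {v | v.length = n}) (x := [])
    (fun _ _ => List.nil_prefix) fun z hz w hw hzw => hzw.eq_of_length (hz.trans hw.symm)
  refine le_trans (ENNReal.tsum_le_tsum fun v => ?_) h
  by_cases hv : v.length = n <;> simp [Set.indicator, hv]

open Classical in
/-- The semimeasure that puts the mass `φ w` on the string `w` and distributes it like `φ` over the
extensions of `w`. -/
noncomputable def restrictTo (φ : List X → ℝ≥0∞) (w z : List X) : ℝ≥0∞ :=
  if w <+: z then φ z else if z <+: w then φ w else 0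

theorem sum_restrictTo_le {φ : List X → ℝ≥0∞} (hφ : ∀ z, ∑ a, φ (z ++ [a]) ≤ φ z)
    (w z : List X) : ∑ a, restrictTo φ w (z ++ [a]) ≤ restrictTo φ w z := by
  classical
  by_cases h : w <+: z
  · have h' : ∀ a, w <+: z ++ [a] := fun a => h.trans (List.prefix_append _ _)
    simpa [restrictTo, h, h'] using hφ z
  · by_cases hz : z <+: w
    · obtain ⟨v, rfl⟩ := hz
      cases v with
      | nil => simp at h
      | cons b v =>
        have hb : ∀ a, a ≠ b → restrictTo φ (z ++ b :: v) (z ++ [a]) = 0 := by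
          intro a ha
          have h1 : ¬ z ++ b :: v <+: z ++ [a] := by
            rw [List.prefix_append_right_inj]
            exact fun h => ha (List.cons_prefix_cons.1 h).1.symm
          have h2 : ¬ z ++ [a] <+: z ++ b :: v := by
            rw [List.prefix_append_right_inj]
            exact fun h => ha (List.cons_prefix_cons.1 h).1
          rw [restrictTo, if_neg h1, if_neg h2]
        rw [Finset.sum_eq_single b (fun a _ ha => hb a ha) (by simp)]
        have h0 : restrictTo φ (z ++ b :: v) z = φ (z ++ b :: v) := by
          rw [restrictTo, if_neg h, if_pos (List.prefix_append _ _)]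
        rw [h0, restrictTo]
        split_ifs with h1 h2
        · rw [List.prefix_append_right_inj] at h1
          have hv : v = [] := by simpa using (List.cons_prefix_cons.1 h1).2
          rw [hv]
        · exact le_rfl
        · exact zero_le
    · have h1 : ∀ a, restrictTo φ w (z ++ [a]) = 0 := by
        intro a
        have h2 : ¬ z ++ [a] <+: w := fun h' => hz ((List.prefix_append _ _).trans h')
        have h3 : ¬ w <+: z ++ [a] := by
          intro h'
          rcases List.prefix_concat_iff.1 (by simpa using h') with h4 | h4
          · exact h2 (by simp [h4])
          · exact h h4
        rw [restrictTo, if_neg h3, if_neg h2]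
      simp [h1]

end Strings

/-! ### Recognizing large randomness deficiency -/

section Dominance

variable {X : Type u}

open Classical in
/-- The mixture of the `ν T` with the algorithmic probabilities of the indices `T` as weights. It is
at least Solomonoff's prior. -/
noncomputable def programMixture [Primcodable X] (U : PrefixMachine X) (ν : ℕ → List X → ℝ≥0∞) (x : List X) :
    ℝ≥0∞ :=
  ∑' (q : List Bool) (T : ℕ), if U.Outputs q [] T then (2⁻¹ : ℝ≥0∞) ^ q.length * ν T x else 0

/-- For a code `n` of the integer `d`, the positive part of `d`; see `two_zpow_eq`. -/
def codePosPart (n : ℕ) : ℕ := bif n.bodd then 0 else n.div2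

/-- For a code `n` of the integer `d`, one more than the negative part of `d`; see `two_zpow_eq`. -/
def codeNegPartSucc (n : ℕ) : ℕ := bif n.bodd then n.div2 + 2 else 1

theorem computable_codePosPart : Computable codePosPart :=
  Computable.cond Computable.nat_bodd (Computable.const 0) Computable.nat_div2

theorem computable_codeNegPartSucc : Computable codeNegPartSucc :=
  Computable.cond Computable.nat_bodd
    (Computable.succ.comp (Computable.succ.comp Computable.nat_div2)) (Computable.const 1)

theorem two_zpow_eq (d : ℤ) : (2 : ℝ) ^ (d - 1) =
    2⁻¹ ^ codeNegPartSucc (Encodable.encode d) * 2 ^ codePosPart (Encodable.encode d) := by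
  rw [zpow_sub_one₀ two_ne_zero]
  cases d with
  | ofNat k =>
    have h : Encodable.encode (Int.ofNat k) = 2 * k := rfl
    have hb : (2 * k).bodd = false := by simp
    have hd : (2 * k).div2 = k := by simp [Nat.div2_val]
    rw [h, codePosPart, codeNegPartSucc, hb, hd]
    simp [mul_comm]
  | negSucc k =>
    have h : Encodable.encode (Int.negSucc k) = 2 * k + 1 := rfl
    have hb : (2 * k + 1).bodd = true := by simp
    have hd : (2 * k + 1).div2 = k := by rw [Nat.div2_val]; omega
    rw [h, codePosPart, codeNegPartSucc, hb, hd, zpow_negSucc]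
    simp only [cond_true, pow_zero, mul_one, inv_pow]
    rw [pow_succ _ (k + 1), mul_inv]

/-- For a code `n` of the integer `d`, the number `2 ^ (d - 1)`. -/
noncomputable def codeScale (n : ℕ) : ℝ≥0∞ := 2⁻¹ ^ codeNegPartSucc n * 2 ^ codePosPart n

open Classical in
/-- The mass that `φ` gives to the strings of the same length as `x` that are different from `x`. -/
noncomputable def massAside (φ : List X → ℝ≥0∞) (x : List X) : ℝ≥0∞ :=
  ∑' v : List X, if v.length = x.length ∧ v ≠ x then φ v else 0

theorem add_massAside (φ : List X → ℝ≥0∞) (x : List X) :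
    φ x + massAside φ x = ∑' v : List X, if v.length = x.length then φ v else 0 := by
  classical
  rw [ENNReal.tsum_eq_add_tsum_ite x, if_pos rfl, massAside]
  congr 1
  refine tsum_congr fun v => ?_
  by_cases h : v = x <;> simp [h]

/-- `2 ^ (d - 1) * (1 - massAside (ν T) x) < M x` for `q = (T, x, n)`, where `n` is a code of `d`,
written without differences and with natural exponents. This implies
`2 ^ (d - 1) * ν T x ≤ M x`, and for a measure `ν T` it is equivalent to the strict inequality. In
contrast to the latter, it is recursively enumerable. -/
def LargeDeficiency (M : List X → ℝ≥0∞) (ν : ℕ → List X → ℝ≥0∞) (q : ℕ × List X × ℕ) : Prop :=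
  (2 : ℝ≥0∞) ^ codePosPart q.2.2 <
    2 ^ codeNegPartSucc q.2.2 * M q.2.1 + 2 ^ codePosPart q.2.2 * massAside (ν q.1) q.2.1

variable {ν : ℕ → List X → ℝ≥0∞}

theorem LargeDeficiency.scale_mul_le [Fintype X] {M : List X → ℝ≥0∞}
    (hν : ∀ T z, ∑ a, ν T (z ++ [a]) ≤ ν T z) (hν1 : ∀ T, ν T [] ≤ 1) {q : ℕ × List X × ℕ}
    (h : LargeDeficiency M ν q) : codeScale q.2.2 * ν q.1 q.2.1 ≤ M q.2.1 := by
  have h1 : ν q.1 q.2.1 + massAside (ν q.1) q.2.1 ≤ 1 := by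
    rw [add_massAside]
    exact (tsum_length_le (hν q.1) _).trans (hν1 q.1)
  have hfin : (2 : ℝ≥0∞) ^ codePosPart q.2.2 * massAside (ν q.1) q.2.1 ≠ ⊤ :=
    ENNReal.mul_ne_top (by simp) (ne_top_of_le_ne_top ENNReal.one_ne_top (le_add_self.trans h1))
  have h2 : (2 : ℝ≥0∞) ^ codePosPart q.2.2 * ν q.1 q.2.1 ≤ 2 ^ codeNegPartSucc q.2.2 * M q.2.1 := by
    refine (ENNReal.add_le_add_iff_right hfin).1 (le_trans ?_ h.le)
    rw [← mul_add]
    exact mul_le_of_le_one_right (zero_le) h1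
  calc codeScale q.2.2 * ν q.1 q.2.1
      = 2⁻¹ ^ codeNegPartSucc q.2.2 * (2 ^ codePosPart q.2.2 * ν q.1 q.2.1) := by
        rw [codeScale, mul_assoc]
    _ ≤ 2⁻¹ ^ codeNegPartSucc q.2.2 * (2 ^ codeNegPartSucc q.2.2 * M q.2.1) := by gcongr
    _ = M q.2.1 := by
        rw [← mul_assoc, mul_comm (2⁻¹ ^ _), two_pow_mul_inv_two_pow, one_mul]

theorem largeDeficiency_of_lt [Fintype X] {M : List X → ℝ≥0∞} {q : ℕ × List X × ℕ}
    (hν : ∀ z, ∑ a, ν q.1 (z ++ [a]) = ν q.1 z) (hν1 : ν q.1 [] = 1)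
    (h : codeScale q.2.2 * ν q.1 q.2.1 < M q.2.1) : LargeDeficiency M ν q := by
  have h1 : ν q.1 q.2.1 + massAside (ν q.1) q.2.1 = 1 := by
    rw [add_massAside, tsum_length_eq, ← hν1, ← sum_append_ofFn hν q.2.1.length []]
    simp
  have hfin : (2 : ℝ≥0∞) ^ codePosPart q.2.2 * massAside (ν q.1) q.2.1 ≠ ⊤ :=
    ENNReal.mul_ne_top (by simp) (ne_top_of_le_ne_top ENNReal.one_ne_top (le_add_self.trans_eq h1))
  have h2 : (2 : ℝ≥0∞) ^ codePosPart q.2.2 * ν q.1 q.2.1 < 2 ^ codeNegPartSucc q.2.2 * M q.2.1 := by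
    calc (2 : ℝ≥0∞) ^ codePosPart q.2.2 * ν q.1 q.2.1
        = 2 ^ codeNegPartSucc q.2.2 * (codeScale q.2.2 * ν q.1 q.2.1) := by
          rw [codeScale, ← mul_assoc, ← mul_assoc, two_pow_mul_inv_two_pow, one_mul]
      _ < _ := (ENNReal.mul_lt_mul_iff_right (by simp) (by simp)).2 h
  calc (2 : ℝ≥0∞) ^ codePosPart q.2.2
      = 2 ^ codePosPart q.2.2 * ν q.1 q.2.1 + 2 ^ codePosPart q.2.2 * massAside (ν q.1) q.2.1 := by
        rw [← mul_add, h1, mul_one]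
    _ < _ := ENNReal.add_lt_add_right hfin h2

theorem lowerSemicomputable_programMixture [Primcodable X] (U : PrefixMachine X)
    (hν : LowerSemicomputable fun q : ℕ × List X => ν q.1 q.2) :
    LowerSemicomputable (programMixture U ν) := by
  classical
  refine LowerSemicomputable.tsum (F := fun x q => ∑' T : ℕ,
    if U.Outputs q [] T then (2⁻¹ : ℝ≥0∞) ^ q.length * ν T x else 0) ?_
  refine LowerSemicomputable.tsum (F := fun (r : List X × List Bool) T =>
    if U.Outputs r.2 [] T then (2⁻¹ : ℝ≥0∞) ^ r.2.length * ν T r.1 else 0) ?_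
  refine ((hν.comp (h := fun s : (List X × List Bool) × ℕ => (s.2, s.1.1)) ?_).inv_two_pow_mul
    (m := fun s => s.1.2.length) ?_).guard
    (rePred_comp U.rePred_outputs (f := fun s : (List X × List Bool) × ℕ => (s.1.2, [], s.2)) ?_)
  · exact Computable.pair Computable.snd (Computable.fst.comp Computable.fst)
  · exact Computable.list_length.comp (Computable.snd.comp Computable.fst)
  · exact Computable.pair (Computable.snd.comp Computable.fst)
      (Computable.pair (Computable.const []) Computable.snd)

theorem sum_programMixture_le [Fintype X] [Primcodable X] (U : PrefixMachine X)
    (hν : ∀ T z, ∑ a, ν T (z ++ [a]) ≤ ν T z)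
    (z : List X) : ∑ a, programMixture U ν (z ++ [a]) ≤ programMixture U ν z := by
  simp only [programMixture]
  rw [← Summable.tsum_finsetSum fun _ _ => ENNReal.summable]
  refine ENNReal.tsum_le_tsum fun q => ?_
  rw [← Summable.tsum_finsetSum fun _ _ => ENNReal.summable]
  refine ENNReal.tsum_le_tsum fun T => ?_
  split_ifs
  · rw [← Finset.mul_sum]
    gcongr
    exact hν T z
  · simp

theorem programMixture_nil_le [Primcodable X] (U : PrefixMachine X) (hν1 : ∀ T, ν T [] ≤ 1) :
    programMixture U ν [] ≤ 1 := by
  refine le_trans ?_ (U.tsum_outputs_le [])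
  refine ENNReal.tsum_le_tsum fun q => ENNReal.tsum_le_tsum fun T => ?_
  split_ifs
  · exact mul_le_of_le_one_right (zero_le) (hν1 T)
  · exact le_rfl

theorem lowerSemicomputable_massAside [Primcodable X]
    (hν : LowerSemicomputable fun q : ℕ × List X => ν q.1 q.2) :
    LowerSemicomputable fun q : ℕ × List X => massAside (ν q.1) q.2 := by
  classical
  refine LowerSemicomputable.tsum (F := fun (q : ℕ × List X) v =>
    if v.length = q.2.length ∧ v ≠ q.2 then ν q.1 v else 0) ?_
  refine (hν.comp (h := fun s : (ℕ × List X) × List X => (s.1.1, s.2)) ?_).guard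
    (p := fun s => s.2.length = s.1.2.length ∧ s.2 ≠ s.1.2) ?_
  · exact Computable.pair (Computable.fst.comp Computable.fst) Computable.snd
  · refine ((PrimrecPred.and ?_ (PrimrecPred.not ?_)).decide.to_comp).computablePred.to_re
    · exact Primrec.eq.comp (Primrec.list_length.comp Primrec.snd)
        (Primrec.list_length.comp (Primrec.snd.comp Primrec.fst))
    · exact Primrec.eq.comp Primrec.snd (Primrec.snd.comp Primrec.fst)

theorem rePred_largeDeficiency [Primcodable X] (U : PrefixMachine X)
    (hν : LowerSemicomputable fun q : ℕ × List X => ν q.1 q.2) :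
    REPred (LargeDeficiency (programMixture U ν) ν) := by
  have hn : Computable fun q : ℕ × List X × ℕ => q.2.2 := Computable.snd.comp Computable.snd
  have hx : Computable fun q : ℕ × List X × ℕ => q.2.1 := Computable.fst.comp Computable.snd
  have h := ((((lowerSemicomputable_programMixture U hν).comp hx).two_pow_mul
    (computable_codeNegPartSucc.comp hn)).add
    (((lowerSemicomputable_massAside hν).comp (Computable.pair Computable.fst hx)).two_pow_mul
      (computable_codePosPart.comp hn))).rePred_lt
    (computable_natPow (Computable.const 2) (computable_codePosPart.comp hn))
    (Computable.const 0)
  refine h.of_eq fun q => ?_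
  simp [LargeDeficiency]

end Dominance

/-! ### The dominating semimeasure -/

section Stopping

variable {X : Type u}

/-- Whether the `m`-th test succeeds, when reading `w`, for a prefix of `w` that extends `x`: the
tests are the pairs of a length and a number of steps of the enumeration `d` of a set of strings,
and a test with number `m` only depends on the first `m` symbols. -/
def testSucceeds (d : List X → ℕ → Bool) (x w : List X) (m : ℕ) : Bool :=
  decide (x.length ≤ m.unpair.1) && d (w.take m.unpair.1) m.unpair.2

/-- `w` is the string read when, beyond `x`, the first test succeeds. -/
def StopsAt (d : List X → ℕ → Bool) (x w : List X) : Prop :=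
  x <+: w ∧ w.length ∈ Nat.rfind fun m => Part.some (testSucceeds d x w m)

theorem stopsAt_iff {d : List X → ℕ → Bool} {x w : List X} :
    StopsAt d x w ↔ x <+: w ∧ testSucceeds d x w w.length = true ∧
      ∀ m < w.length, testSucceeds d x w m = false := by
  refine and_congr_right fun _ => Nat.mem_rfind.trans ?_
  simp only [Part.mem_some_iff]
  constructor
  · exact fun h => ⟨h.1.symm, fun m hm => (h.2 hm).symm⟩
  · exact fun h => ⟨h.1.symm, fun {m} hm => (h.2 m hm).symm⟩

theorem testSucceeds_of_prefix {d : List X → ℕ → Bool} {x w z : List X} (h : w <+: z) {m : ℕ}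
    (hm : m ≤ w.length) : testSucceeds d x w m = testSucceeds d x z m := by
  obtain ⟨v, rfl⟩ := h
  rw [testSucceeds, testSucceeds, List.take_append_of_le_length ((Nat.unpair_left_le m).trans hm)]

theorem StopsAt.eq_of_prefix {d : List X → ℕ → Bool} {x w z : List X} (hw : StopsAt d x w)
    (hz : StopsAt d x z) (h : w <+: z) : w = z := by
  rw [stopsAt_iff] at hw hz
  by_contra hne
  have hlt : w.length < z.length := lt_of_le_of_ne h.length_le fun h' => hne (h.eq_of_length h')
  have h1 := hz.2.2 _ hlt
  rw [← testSucceeds_of_prefix h le_rfl, hw.2.1] at h1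
  simp at h1

theorem StopsAt.exists_prefix {d : List X → ℕ → Bool} {x w : List X} (h : StopsAt d x w) :
    ∃ v s, x <+: v ∧ v <+: w ∧ d v s = true := by
  have h' := stopsAt_iff.1 h
  obtain ⟨h1, h2⟩ := Bool.and_eq_true_iff.1 h'.2.1
  refine ⟨_, _, ?_, List.take_prefix _ _, h2⟩
  refine List.prefix_of_prefix_length_le h.1 (List.take_prefix _ _) ?_
  rw [List.length_take]
  exact le_min (of_decide_eq_true h1) h.1.length_le

/-- If a prefix `v` of `z` is enumerated within `s` steps, then the search stops at a prefix of `z`,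
provided that `z` is long enough for the test with the number of `(ℓ(v), s)`. -/
theorem exists_stopsAt {d : List X → ℕ → Bool} {x v : List X} {s : ℕ} (hx : x <+: v)
    (hd : d v s = true) {z : List X} (hz : v <+: z) (hl : Nat.pair v.length s ≤ z.length) :
    ∃ w, StopsAt d x w ∧ w <+: z := by
  have hex : ∃ m, testSucceeds d x z m = true := by
    refine ⟨Nat.pair v.length s, ?_⟩
    rw [testSucceeds, Nat.unpair_pair, ← List.prefix_iff_eq_take.1 hz, hd]
    simpa using hx.length_le
  have hle : Nat.find hex ≤ z.length := by
    refine (Nat.find_min' hex ?_).trans hl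
    rw [testSucceeds, Nat.unpair_pair, ← List.prefix_iff_eq_take.1 hz, hd]
    simpa using hx.length_le
  have hlen : (z.take (Nat.find hex)).length = Nat.find hex := by simpa using hle
  refine ⟨z.take (Nat.find hex), stopsAt_iff.2 ⟨?_, ?_, fun m hm => ?_⟩, List.take_prefix _ _⟩
  · refine List.prefix_of_prefix_length_le (hx.trans hz) (List.take_prefix _ _) ?_
    rw [hlen]
    exact (of_decide_eq_true (Bool.and_eq_true_iff.1 (Nat.find_spec hex)).1).trans
      (Nat.unpair_left_le _)
  · rw [testSucceeds_of_prefix (List.take_prefix _ _) le_rfl, hlen]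
    exact Nat.find_spec hex
  · rw [testSucceeds_of_prefix (List.take_prefix _ _) hm.le]
    rw [hlen] at hm
    simpa using Nat.find_min hex hm

theorem rePred_prefix [Primcodable X] :
    REPred fun q : List X × List X => q.1 <+: q.2 := by
  classical
  have h : PrimrecPred fun q : List X × List X => q.1 = q.2.take q.1.length :=
    Primrec.eq.comp Primrec.fst
      (Primrec.list_take.comp (Primrec.list_length.comp Primrec.fst) Primrec.snd)
  exact h.decide.to_comp.computablePred.to_re.of_eq fun q => List.prefix_iff_eq_take.symm

theorem rePred_stopsAt {α : Type*} [Primcodable α] [Primcodable X] {d : α → List X → ℕ → Bool}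
    (hd : Computable fun q : (α × List X) × ℕ => d q.1.1 q.1.2 q.2) :
    REPred fun q : α × List X × List X => StopsAt (d q.1) q.2.1 q.2.2 := by
  have h : Computable₂ fun (q : α × List X × List X) (m : ℕ) =>
      testSucceeds (d q.1) q.2.1 q.2.2 m := by
    have hm : Computable fun r : (α × List X × List X) × ℕ => r.2.unpair :=
      Computable.unpair.comp Computable.snd
    have hm1 : Computable fun r : (α × List X × List X) × ℕ => r.2.unpair.1 :=
      Computable.fst.comp hm
    have hm2 : Computable fun r : (α × List X × List X) × ℕ => r.2.unpair.2 :=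
      Computable.snd.comp hm
    have hx : Computable fun r : (α × List X × List X) × ℕ => r.1.2.1.length :=
      Computable.list_length.comp (Computable.fst.comp (Computable.snd.comp Computable.fst))
    have ht : Computable fun r : (α × List X × List X) × ℕ => r.1.2.2.take r.2.unpair.1 :=
      (Primrec.list_take (α := X)).to_comp.comp hm1
        (Computable.snd.comp (Computable.snd.comp Computable.fst))
    have h1 : Computable fun r : (α × List X × List X) × ℕ =>
        decide (r.1.2.1.length ≤ r.2.unpair.1) :=
      Primrec.nat_le.decide.to_comp.comp hx hm1
    have h2 : Computable fun r : (α × List X × List X) × ℕ =>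
        d r.1.1 (r.1.2.2.take r.2.unpair.1) r.2.unpair.2 :=
      Computable.comp (f := fun q : (α × List X) × ℕ => d q.1.1 q.1.2 q.2)
        (g := fun r : (α × List X × List X) × ℕ =>
          ((r.1.1, r.1.2.2.take r.2.unpair.1), r.2.unpair.2)) hd
        (Computable.pair (Computable.pair (Computable.fst.comp Computable.fst) ht) hm2)
    exact Primrec.and.to_comp.comp h1 h2
  exact rePred_and (rePred_comp rePred_prefix Computable.snd)
    (rePred_mem (Partrec.rfind h.partrec₂)
      (Computable.list_length.comp (Computable.snd.comp Computable.snd)))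

/-- If `c * φ ≤ M` on a set that is enumerated by `d`, then the strings at which the tests for
membership of a prefix stop have `c * φ`-mass at most `M x`, although `c * φ ≤ M` may fail for
these strings themselves. -/
theorem tsum_stopsAt_le [Fintype X] {φ M : List X → ℝ≥0∞} (hφ : ∀ z, ∑ a, φ (z ++ [a]) ≤ φ z)
    (hM : ∀ z, ∑ a, M (z ++ [a]) ≤ M z) {c : ℝ≥0∞} {d : List X → ℕ → Bool}
    (hd : ∀ v s, d v s = true → c * φ v ≤ M v) (x : List X) :
    ∑' w, {w | StopsAt d x w}.indicator (fun w => c * φ w) w ≤ M x := by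
  classical
  -- `ψ` follows `M` until it reaches the enumerated set and `c * φ` afterwards.
  let E : List X → Prop := fun z => ∃ v s, x <+: v ∧ v <+: z ∧ d v s = true
  let ψ : List X → ℝ≥0∞ := fun z => if E z then c * φ z else M z
  have hψM : ∀ z, (∀ v s, x <+: v → v <+: z → d v s = true → v = z) → ψ z ≤ M z := by
    intro z hz
    by_cases h : E z
    · obtain ⟨v, s, hxv, hvz, hv⟩ := h
      have hE : E z := ⟨v, s, hxv, hvz, hv⟩
      simp only [ψ, if_pos hE]
      obtain rfl := hz v s hxv hvz hv
      exact hd v s hv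
    · simp [ψ, if_neg h]
  have hψ : ∀ z, ∑ a, ψ (z ++ [a]) ≤ ψ z := by
    intro z
    by_cases h : E z
    · have h' : ∀ a, E (z ++ [a]) := fun a => by
        obtain ⟨v, s, hxv, hvz, hv⟩ := h
        exact ⟨v, s, hxv, hvz.trans (List.prefix_append _ _), hv⟩
      simp only [ψ, if_pos h, h', if_true]
      rw [← Finset.mul_sum]
      gcongr
      exact hφ z
    · calc ∑ a, ψ (z ++ [a]) ≤ ∑ a, M (z ++ [a]) := by
            refine Finset.sum_le_sum fun a _ => hψM _ fun v s hxv hvz hv => ?_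
            rcases List.prefix_concat_iff.1 (by simpa using hvz) with h4 | h4
            · simpa using h4
            · exact absurd ⟨v, s, hxv, h4, hv⟩ h
        _ ≤ M z := hM z
        _ = ψ z := by simp [ψ, if_neg h]
  have h := tsum_indicator_prefixFree_le hψ (A := {w | StopsAt d x w}) (x := x)
    (fun w hw => hw.1) fun z hz w hw hzw => hz.eq_of_prefix hw hzw
  refine le_trans (ENNReal.tsum_le_tsum fun w => ?_) (h.trans (hψM x fun v s h1 h2 _ =>
    h2.eq_of_length (le_antisymm h2.length_le h1.length_le)))
  by_cases hw : w ∈ {w | StopsAt d x w}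
  · rw [Set.indicator_of_mem hw, Set.indicator_of_mem hw]
    have hE : E w := by
      obtain ⟨v, s, h1, h2, h3⟩ := StopsAt.exists_prefix hw
      exact ⟨v, s, h1, h2, h3⟩
    simp [ψ, if_pos hE]
  · simp [hw]

end Stopping

section Dominating

variable {X : Type u} [Primcodable X]

/-- The computations `i = (q, n, p, x, T, w)` from which `dominatingSemimeasure` is put together: a
program `q` for a code `n` of an integer, a pair `(p, x)` on which the twice prefix machine halts
with output `T`, and the extension `w` of `x` at which the search for a string enumerated by
`d (n, T)` stops. -/
structure IsWitness (U : PrefixMachine X) (W : TwicePrefixMachine X)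
    (d : ℕ × ℕ → List X → ℕ → Bool)
    (i : List Bool × ℕ × List Bool × List X × ℕ × List X) : Prop where
  program : U.Outputs i.1 [] i.2.1
  outputs : W.Outputs i.2.2.1 i.2.2.2.1 i.2.2.2.2.1
  stopsAt : StopsAt (d (i.2.1, i.2.2.2.2.1)) i.2.2.2.1 i.2.2.2.2.2

open Classical in
/-- The sum over all `q`, `p`, `x` with `U(q) = n` and `W(p, x) = T`, where `n` is a code of an integer
`e`, and over all `w` at which the search for a string enumerated by `d (n, T)` stops, of the
semimeasure `2 ^ (-ℓ(q) - ℓ(p) + e - 1) * ν T` restricted to `w`. In the application `d (n, T)`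
enumerates strings with `2 ^ (e - 1) * ν T ≤ M`, which bounds the total mass. -/
noncomputable def dominatingSemimeasure (U : PrefixMachine X) (W : TwicePrefixMachine X)
    (ν : ℕ → List X → ℝ≥0∞) (d : ℕ × ℕ → List X → ℕ → Bool) (z : List X) : ℝ≥0∞ :=
  ∑' i : List Bool × ℕ × List Bool × List X × ℕ × List X,
    if IsWitness U W d i then
      2⁻¹ ^ i.1.length * (2⁻¹ ^ i.2.2.1.length *
        (codeScale i.2.1 * restrictTo (ν i.2.2.2.2.1) i.2.2.2.2.2 z))
    else 0

theorem lowerSemicomputable_restrictTo {ν : ℕ → List X → ℝ≥0∞}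
    (hν : LowerSemicomputable fun q : ℕ × List X => ν q.1 q.2) :
    LowerSemicomputable fun q : (ℕ × List X) × List X => restrictTo (ν q.1.1) q.1.2 q.2 := by
  classical
  have h1 := (hν.comp (h := fun q : (ℕ × List X) × List X => (q.1.1, q.2))
    (Computable.pair (Computable.fst.comp Computable.fst) Computable.snd)).guard
    (rePred_comp rePred_prefix (f := fun q : (ℕ × List X) × List X => (q.1.2, q.2))
      (Computable.pair (Computable.snd.comp Computable.fst) Computable.snd))
  have hne : REPred fun q : (ℕ × List X) × List X => q.2 ≠ q.1.2 :=
    ((PrimrecPred.not (Primrec.eq.comp Primrec.snd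
      (Primrec.snd.comp Primrec.fst))).decide.to_comp).computablePred.to_re
  have h2 := (hν.comp (h := fun q : (ℕ × List X) × List X => (q.1.1, q.1.2))
    (Computable.pair (Computable.fst.comp Computable.fst)
      (Computable.snd.comp Computable.fst))).guard
    (rePred_and (rePred_comp rePred_prefix (f := fun q : (ℕ × List X) × List X => (q.2, q.1.2))
      (Computable.pair Computable.snd (Computable.snd.comp Computable.fst))) hne)
  refine (h1.add h2).of_eq fun q => ?_
  by_cases hw : q.1.2 <+: q.2
  · have h3 : ¬ (q.2 <+: q.1.2 ∧ q.2 ≠ q.1.2) := fun h =>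
      h.2 (h.1.eq_of_length (le_antisymm h.1.length_le hw.length_le))
    simp only [restrictTo, if_pos hw, if_neg h3, add_zero]
  · have h3 : q.2 <+: q.1.2 ∧ q.2 ≠ q.1.2 ↔ q.2 <+: q.1.2 :=
      and_iff_left_of_imp fun _ h => hw (by rw [h])
    simp only [restrictTo, if_neg hw, h3, zero_add]

theorem lowerSemicomputable_dominatingSemimeasure (U : PrefixMachine X)
    (W : TwicePrefixMachine X) {ν : ℕ → List X → ℝ≥0∞}
    (hν : LowerSemicomputable fun q : ℕ × List X => ν q.1 q.2) {d : ℕ × ℕ → List X → ℕ → Bool}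
    (hd : Computable fun q : ((ℕ × ℕ) × List X) × ℕ => d q.1.1 q.1.2 q.2) :
    LowerSemicomputable (dominatingSemimeasure U W ν d) := by
  classical
  let ι := List Bool × ℕ × List Bool × List X × ℕ × List X
  have hq : Computable fun r : List X × ι => r.2.1 := Computable.fst.comp Computable.snd
  have h1 : Computable fun r : List X × ι => r.2.2 := Computable.snd.comp Computable.snd
  have hn : Computable fun r : List X × ι => r.2.2.1 := Computable.fst.comp h1
  have h2 : Computable fun r : List X × ι => r.2.2.2 := Computable.snd.comp h1
  have hp : Computable fun r : List X × ι => r.2.2.2.1 := Computable.fst.comp h2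
  have h3 : Computable fun r : List X × ι => r.2.2.2.2 := Computable.snd.comp h2
  have hx : Computable fun r : List X × ι => r.2.2.2.2.1 := Computable.fst.comp h3
  have h4 : Computable fun r : List X × ι => r.2.2.2.2.2 := Computable.snd.comp h3
  have hT : Computable fun r : List X × ι => r.2.2.2.2.2.1 := Computable.fst.comp h4
  have hw : Computable fun r : List X × ι => r.2.2.2.2.2.2 := Computable.snd.comp h4
  have hP : REPred fun r : List X × ι => IsWitness U W d r.2 := by
    refine (rePred_and (rePred_comp U.rePred_outputs
        (Computable.pair hq (Computable.pair (Computable.const []) hn)))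
      (rePred_and (rePred_comp W.rePred_outputs (Computable.pair hp (Computable.pair hx hT)))
        (rePred_comp (rePred_stopsAt hd) (Computable.pair (Computable.pair hn hT)
          (Computable.pair hx hw))))).of_eq fun r => ?_
    exact ⟨fun h => ⟨h.1, h.2.1, h.2.2⟩, fun h => ⟨h.1, h.2, h.3⟩⟩
  refine LowerSemicomputable.tsum (F := fun z (i : ι) =>
    if IsWitness U W d i then
      2⁻¹ ^ i.1.length * (2⁻¹ ^ i.2.2.1.length *
        (codeScale i.2.1 * restrictTo (ν i.2.2.2.2.1) i.2.2.2.2.2 z))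
    else 0) ?_
  refine LowerSemicomputable.guard (LowerSemicomputable.inv_two_pow_mul
    (LowerSemicomputable.inv_two_pow_mul ?_ (Computable.list_length.comp hp))
    (Computable.list_length.comp hq)) hP
  refine (((((lowerSemicomputable_restrictTo hν).comp (Computable.pair (Computable.pair hT hw)
    Computable.fst)).two_pow_mul (computable_codePosPart.comp hn)).inv_two_pow_mul
    (computable_codeNegPartSucc.comp hn))).of_eq fun r => ?_
  rw [codeScale, mul_assoc]

theorem sum_dominatingSemimeasure_le [Fintype X] (U : PrefixMachine X) (W : TwicePrefixMachine X)
    {ν : ℕ → List X → ℝ≥0∞} (hν : ∀ T z, ∑ a, ν T (z ++ [a]) ≤ ν T z)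
    (d : ℕ × ℕ → List X → ℕ → Bool) (z : List X) :
    ∑ a, dominatingSemimeasure U W ν d (z ++ [a]) ≤ dominatingSemimeasure U W ν d z := by
  simp only [dominatingSemimeasure]
  rw [← Summable.tsum_finsetSum fun _ _ => ENNReal.summable]
  refine ENNReal.tsum_le_tsum fun i => ?_
  split_ifs
  · simp only [← Finset.mul_sum]
    gcongr
    exact sum_restrictTo_le (hν _) _ z
  · simp

theorem dominatingSemimeasure_nil_le [Fintype X] (U : PrefixMachine X) (W : TwicePrefixMachine X)
    {ν : ℕ → List X → ℝ≥0∞} (hν : ∀ T z, ∑ a, ν T (z ++ [a]) ≤ ν T z)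
    {M : List X → ℝ≥0∞} (hM : ∀ z, ∑ a, M (z ++ [a]) ≤ M z) (hM1 : M [] ≤ 1)
    {d : ℕ × ℕ → List X → ℕ → Bool}
    (hd : ∀ n T v s, d (n, T) v s = true → codeScale n * ν T v ≤ M v) :
    dominatingSemimeasure U W ν d [] ≤ 1 := by
  classical
  calc dominatingSemimeasure U W ν d []
      = ∑' (q : List Bool) (n : ℕ) (p : List Bool) (x : List X) (T : ℕ) (w : List X),
        if IsWitness U W d (q, n, p, x, T, w) then
          2⁻¹ ^ q.length * (2⁻¹ ^ p.length * (codeScale n * ν T w)) else 0 := by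
        have hnil : ∀ φ : List X → ℝ≥0∞, ∀ w, restrictTo φ w [] = φ w := by
          intro φ w
          by_cases h : w = [] <;> simp [restrictTo, h]
        simp only [dominatingSemimeasure, ENNReal.tsum_prod', hnil]
    _ ≤ ∑' (q : List Bool) (n : ℕ), (if U.Outputs q [] n then 2⁻¹ ^ q.length else 0) *
        ∑' (p : List Bool) (x : List X) (T : ℕ),
          if W.Outputs p x T then 2⁻¹ ^ p.length * M x else 0 := by
        simp only [← ENNReal.tsum_mul_left]
        refine ENNReal.tsum_le_tsum fun q => ENNReal.tsum_le_tsum fun n =>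
          ENNReal.tsum_le_tsum fun p => ENNReal.tsum_le_tsum fun x =>
          ENNReal.tsum_le_tsum fun T => ?_
        by_cases h1 : U.Outputs q [] n
        · by_cases h2 : W.Outputs p x T
          · rw [if_pos h1, if_pos h2, ← mul_assoc]
            refine le_trans (le_of_eq ?_) (mul_le_mul_right (tsum_stopsAt_le (hν T) hM
              (fun v s h => hd n T v s h) x) _)
            rw [← ENNReal.tsum_mul_left]
            refine tsum_congr fun w => ?_
            by_cases h3 : StopsAt (d (n, T)) x w
            · have h4 : IsWitness U W d (q, n, p, x, T, w) := ⟨h1, h2, h3⟩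
              rw [if_pos h4, Set.indicator_of_mem (by exact h3), mul_assoc]
            · have h4 : ¬ IsWitness U W d (q, n, p, x, T, w) := fun h => h3 h.3
              rw [if_neg h4, Set.indicator_of_notMem (by exact h3), mul_zero]
          · have h4 : ∀ w, ¬ IsWitness U W d (q, n, p, x, T, w) := fun w h => h2 h.2
            simp [h4]
        · have h4 : ∀ w, ¬ IsWitness U W d (q, n, p, x, T, w) := fun w h => h1 h.1
          simp [h4]
    _ ≤ ∑' (q : List Bool) (n : ℕ), (if U.Outputs q [] n then 2⁻¹ ^ q.length else 0) * 1 := by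
        refine ENNReal.tsum_le_tsum fun q => ENNReal.tsum_le_tsum fun n => ?_
        gcongr
        exact (W.tsum_outputs_le hM).trans hM1
    _ ≤ 1 := by
        simp only [mul_one]
        exact U.tsum_outputs_le []

/-- Along the extensions `z` of a string `x` of large deficiency, the dominating semimeasure is
large, from some length on. The length is the time needed to recognize the large deficiency. -/
theorem exists_le_dominatingSemimeasure {U : PrefixMachine X} {W : TwicePrefixMachine X}
    {ν : ℕ → List X → ℝ≥0∞} {d : ℕ × ℕ → List X → ℕ → Bool} {q p : List Bool} {n T s : ℕ}
    {y x : List X} (hq : U.Outputs q [] n) (hp : W.Outputs p y T) (hyx : y <+: x)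
    (hd : d (n, T) x s = true) :
    ∃ N, ∀ z, x <+: z → N ≤ z.length →
      2⁻¹ ^ q.length * (2⁻¹ ^ p.length * (codeScale n * ν T z)) ≤
        dominatingSemimeasure U W ν d z := by
  classical
  refine ⟨Nat.pair x.length s, fun z hxz hz => ?_⟩
  obtain ⟨w, hw, hwz⟩ := exists_stopsAt hyx hd hxz hz
  have h : IsWitness U W d (q, n, p, y, T, w) := ⟨hq, hp, hw⟩
  refine le_trans (le_of_eq ?_) (ENNReal.le_tsum (q, n, p, y, T, w))
  rw [if_pos h, restrictTo, if_pos hwz]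

end Dominating

/-! ### Deviations are at most the Kullback-Leibler divergence -/

section Pinsker

/-- The derivative of `u * log u - u + 1 - 3 / 2 * ((u - 1) ^ 2 / (u + 2))` increases. -/
theorem log_sub_rational_mono {u v : ℝ} (hu : 0 < u) (huv : u ≤ v) :
    Real.log u - 3 / 2 * (1 - 9 / (u + 2) ^ 2) ≤ Real.log v - 3 / 2 * (1 - 9 / (v + 2) ^ 2) := by
  have hd : ∀ x ∈ Set.Ioi (0 : ℝ), HasDerivAt
      (fun u => Real.log u - 3 / 2 * (1 - 9 / (u + 2) ^ 2))
      (1 / x - 27 / (x + 2) ^ 3) x := by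
    intro x hx
    have hx' : (0 : ℝ) < x := hx
    have h2 : (x + 2) ≠ 0 := by positivity
    have h := ((Real.hasDerivAt_log hx'.ne').sub (((((hasDerivAt_id x).add_const 2).pow 2).fun_inv
      (pow_ne_zero 2 h2)).const_mul 9 |>.const_sub 1 |>.const_mul (3 / 2)))
    refine (h.congr_of_eventuallyEq (.of_eq (funext fun y => ?_))).congr_deriv ?_
    · simp [div_eq_mul_inv]
    · simp only [id, Pi.pow_apply]
      field_simp
      ring
  refine monotoneOn_of_deriv_nonneg (convex_Ioi 0)
    (fun x hx => (hd x hx).continuousAt.continuousWithinAt)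
    (fun x hx => (hd x (interior_subset hx)).differentiableAt.differentiableWithinAt)
    (fun x hx => ?_) hu (hu.trans_le huv) huv
  rw [(hd x (interior_subset hx)).deriv]
  have hx' : (0 : ℝ) < x := interior_subset hx
  rw [sub_nonneg, div_le_div_iff₀ (by positivity) hx']
  -- By the inequality of arithmetic and geometric means for `x`, `1` and `1`.
  nlinarith [mul_nonneg (sq_nonneg (x - 1)) (by linarith : (0 : ℝ) ≤ x + 8)]

/-- Divided by `4 + 2 * u`, the difference of the two sides has its minimum `0` at `u = 1`. -/
theorem three_mul_sub_one_sq_le {u : ℝ} (hu : 0 < u) :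
    3 * (u - 1) ^ 2 ≤ (4 + 2 * u) * (u * Real.log u - u + 1) := by
  have hd : ∀ x ∈ Set.Ioi (0 : ℝ), HasDerivAt
      (fun u => u * Real.log u - u + 1 - 3 / 2 * ((u - 1) ^ 2 / (u + 2)))
      (Real.log x - 3 / 2 * (1 - 9 / (x + 2) ^ 2)) x := by
    intro x hx
    have hx' : (0 : ℝ) < x := hx
    have h2 : (x + 2) ≠ 0 := by positivity
    have h := ((((hasDerivAt_id x).mul (Real.hasDerivAt_log hx'.ne')).sub
      (hasDerivAt_id x)).add_const 1).sub (((((hasDerivAt_id x).sub_const 1).pow 2).div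
        ((hasDerivAt_id x).add_const 2) h2).const_mul (3 / 2))
    refine (h.congr_of_eventuallyEq (.of_eq (funext fun y => ?_))).congr_deriv ?_
    · simp [div_eq_mul_inv]
    · simp only [id, Pi.pow_apply]
      field_simp
      ring
  have h0 : Real.log 1 - 3 / 2 * (1 - 9 / ((1 : ℝ) + 2) ^ 2) = 0 := by norm_num
  have key : 0 ≤ u * Real.log u - u + 1 - 3 / 2 * ((u - 1) ^ 2 / (u + 2)) := by
    have h1 : (1 : ℝ) * Real.log 1 - 1 + 1 - 3 / 2 * ((1 - 1) ^ 2 / (1 + 2)) = 0 := by norm_num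
    rw [← h1]
    rcases le_total u 1 with hle | hle
    · refine antitoneOn_of_deriv_nonpos (D := Set.Icc u 1)
        (f := fun u => u * Real.log u - u + 1 - 3 / 2 * ((u - 1) ^ 2 / (u + 2))) (convex_Icc u 1)
        (fun x hx => (hd x (hu.trans_le hx.1)).continuousAt.continuousWithinAt)
        (fun x hx => (hd x (hu.trans_le
          (interior_subset hx).1)).differentiableAt.differentiableWithinAt)
        (fun x hx => ?_) (Set.left_mem_Icc.2 hle) (Set.right_mem_Icc.2 hle) hle
      have hx' := interior_subset hx
      rw [(hd x (hu.trans_le hx'.1)).deriv, ← h0]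
      exact log_sub_rational_mono (hu.trans_le hx'.1) hx'.2
    · refine monotoneOn_of_deriv_nonneg (D := Set.Icc 1 u)
        (f := fun u => u * Real.log u - u + 1 - 3 / 2 * ((u - 1) ^ 2 / (u + 2))) (convex_Icc 1 u)
        (fun x hx => (hd x (one_pos.trans_le hx.1)).continuousAt.continuousWithinAt)
        (fun x hx => (hd x (one_pos.trans_le
          (interior_subset hx).1)).differentiableAt.differentiableWithinAt)
        (fun x hx => ?_) (Set.left_mem_Icc.2 hle) (Set.right_mem_Icc.2 hle) hle
      have hx' := interior_subset hx
      rw [(hd x (one_pos.trans_le hx'.1)).deriv, ← h0]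
      exact log_sub_rational_mono one_pos hx'.1
  have h2 : 3 / 2 * ((u - 1) ^ 2 / (u + 2)) * (4 + 2 * u) = 3 * (u - 1) ^ 2 := by
    field_simp
    ring
  have h3 := mul_nonneg key (by linarith : (0 : ℝ) ≤ 4 + 2 * u)
  rw [sub_mul, h2] at h3
  linarith

/-- The contribution of one symbol to the Pinsker inequality; `D` will be the total distance. -/
theorem mul_abs_sub_le_mul_log {ρ μ : ℝ} (hρ : 0 ≤ ρ) (hμ : 0 ≤ μ) (h : ρ = 0 → μ = 0) (D : ℝ) :
    D * |ρ - μ| - D ^ 2 * (4 * ρ + 2 * μ) / 12 ≤ μ * Real.log (μ / ρ) - μ + ρ := by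
  rcases hρ.eq_or_lt with rfl | hρ
  · simp [h rfl]
  rcases hμ.eq_or_lt with rfl | hμ
  · simp only [sub_zero, abs_of_pos hρ, zero_mul, zero_add, mul_zero, add_zero]
    nlinarith [mul_nonneg hρ.le (sq_nonneg (2 * D - 3))]
  have h1 := three_mul_sub_one_sq_le (div_pos hμ hρ)
  have h2 : 3 * (ρ - μ) ^ 2 ≤ (4 * ρ + 2 * μ) * (μ * Real.log (μ / ρ) - μ + ρ) := by
    have h3 := mul_le_mul_of_nonneg_left h1 (sq_nonneg ρ)
    have h4 : ρ ^ 2 * (3 * (μ / ρ - 1) ^ 2) = 3 * (ρ - μ) ^ 2 := by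
      field_simp
      ring
    have h5 : ρ ^ 2 * ((4 + 2 * (μ / ρ)) * (μ / ρ * Real.log (μ / ρ) - μ / ρ + 1))
        = (4 * ρ + 2 * μ) * (μ * Real.log (μ / ρ) - μ + ρ) := by
      generalize Real.log (μ / ρ) = L
      field_simp
    rwa [h4, h5] at h3
  have hg : 0 < 4 * ρ + 2 * μ := by positivity
  refine le_of_mul_le_mul_left ?_ hg
  refine le_trans ?_ h2
  nlinarith [sq_nonneg (6 * |ρ - μ| - D * (4 * ρ + 2 * μ)), sq_abs (ρ - μ)]

/-- The Pinsker inequality. The quadratic bound for single symbols is summed with the total distance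
for the parameter `D`, which is the choice that makes it sharpest. -/
theorem half_sq_sum_abs_le {ι : Type*} [Fintype ι] {ρ μ : ι → ℝ} (hρ : ∀ a, 0 ≤ ρ a)
    (hμ : ∀ a, 0 ≤ μ a) (h : ∀ a, ρ a = 0 → μ a = 0) (hρ1 : ∑ a, ρ a = 1) (hμ1 : ∑ a, μ a = 1) :
    1 / 2 * (∑ a, |ρ a - μ a|) ^ 2 ≤ ∑ a, μ a * Real.log (μ a / ρ a) := by
  set D := ∑ a, |ρ a - μ a| with hD
  have h1 := Finset.sum_le_sum fun a (_ : a ∈ Finset.univ) =>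
    mul_abs_sub_le_mul_log (hρ a) (hμ a) (h a) D
  simp only [Finset.sum_sub_distrib, Finset.sum_add_distrib, ← Finset.mul_sum, ← Finset.sum_div,
    hρ1, hμ1, ← hD] at h1
  linarith

variable {X : Type u} [Fintype X] {ρ μ : X → ℝ}

/-- The Pinsker inequality for a subprobability `ρ`, which is completed by an additional symbol. -/
theorem half_sq_sum_abs_add_le (hρ : ∀ a, 0 ≤ ρ a)
    (hμ : ∀ a, 0 ≤ μ a) (h : ∀ a, ρ a = 0 → μ a = 0) (hρ1 : ∑ a, ρ a ≤ 1) (hμ1 : ∑ a, μ a = 1) :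
    1 / 2 * (∑ a, |ρ a - μ a| + (1 - ∑ a, ρ a)) ^ 2 ≤ klDivergence ρ μ := by
  have h1 := half_sq_sum_abs_le (ι := Option X) (ρ := fun o => o.elim (1 - ∑ a, ρ a) ρ)
    (μ := fun o => o.elim 0 μ) (by rintro (_ | a) <;> simp [hρ1, hρ])
    (by rintro (_ | a) <;> simp [hμ]) (by rintro (_ | a) <;> simp; exact h a)
    (by simp [Fintype.sum_option]) (by simp [Fintype.sum_option, hμ1])
  simp only [Fintype.sum_option, Option.elim_none, Option.elim_some, sub_zero, zero_mul,
    zero_add, abs_of_nonneg (sub_nonneg.2 hρ1)] at h1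
  rwa [add_comm, klDivergence]

theorem squaredDistance_le_klDivergence (hρ : ∀ a, 0 ≤ ρ a)
    (hμ : ∀ a, 0 ≤ μ a) (h : ∀ a, ρ a = 0 → μ a = 0) (hρ1 : ∑ a, ρ a ≤ 1) (hμ1 : ∑ a, μ a = 1) :
    squaredDistance ρ μ ≤ klDivergence ρ μ := by
  classical
  refine le_trans ?_ (half_sq_sum_abs_add_le hρ hμ h hρ1 hμ1)
  set D := ∑ a, |ρ a - μ a| with hD
  set r := 1 - ∑ a, ρ a with hr
  have hr0 : 0 ≤ r := sub_nonneg.2 hρ1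
  have hD0 : 0 ≤ D := Finset.sum_nonneg fun a _ => abs_nonneg _
  -- The differences and `r` have sum zero, so each is at most the total of the others.
  have hmax : ∀ a, |ρ a - μ a| ≤ (D + r) / 2 := by
    intro a
    have h1 : ∑ b, (ρ b - μ b) = -r := by
      rw [Finset.sum_sub_distrib, hμ1]
      ring
    have h2 := Finset.add_sum_erase Finset.univ (fun b => ρ b - μ b) (Finset.mem_univ a)
    have h3 := Finset.add_sum_erase Finset.univ (fun b => |ρ b - μ b|) (Finset.mem_univ a)
    have h4 := Finset.abs_sum_le_sum_abs (fun b => ρ b - μ b) (Finset.univ.erase a)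
    rw [h1] at h2
    have h5 : ρ a - μ a = -(r + ∑ b ∈ Finset.univ.erase a, (ρ b - μ b)) := by linarith
    have h6 : |ρ a - μ a| ≤ r + |∑ b ∈ Finset.univ.erase a, (ρ b - μ b)| := by
      rw [h5, abs_neg]
      exact (abs_add_le _ _).trans_eq (by rw [abs_of_nonneg hr0])
    linarith
  calc squaredDistance ρ μ = ∑ a, |ρ a - μ a| * |ρ a - μ a| :=
        Finset.sum_congr rfl fun a _ => by rw [abs_mul_abs_self, sq]
    _ ≤ ∑ a, |ρ a - μ a| * ((D + r) / 2) :=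
        Finset.sum_le_sum fun a _ => mul_le_mul_of_nonneg_left (hmax a) (abs_nonneg _)
    _ = D * ((D + r) / 2) := by rw [← Finset.sum_mul]
    _ ≤ 1 / 2 * (D + r) ^ 2 := by nlinarith [mul_nonneg hr0 hD0]

theorem squaredAbsoluteDistance_le_klDivergence (hρ : ∀ a, 0 ≤ ρ a)
    (hμ : ∀ a, 0 ≤ μ a) (h : ∀ a, ρ a = 0 → μ a = 0) (hρ1 : ∑ a, ρ a ≤ 1) (hμ1 : ∑ a, μ a = 1) :
    squaredAbsoluteDistance ρ μ ≤ klDivergence ρ μ := by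
  refine le_trans ?_ (half_sq_sum_abs_add_le hρ hμ h hρ1 hμ1)
  rw [squaredAbsoluteDistance]
  have : 0 ≤ ∑ a, |ρ a - μ a| := Finset.sum_nonneg fun a _ => abs_nonneg _
  gcongr
  linarith

theorem hellingerDistance_le_klDivergence (hρ : ∀ a, 0 ≤ ρ a)
    (hμ : ∀ a, 0 ≤ μ a) (h : ∀ a, ρ a = 0 → μ a = 0) (hρ1 : ∑ a, ρ a ≤ 1) (hμ1 : ∑ a, μ a = 1) :
    hellingerDistance ρ μ ≤ klDivergence ρ μ := by
  have key : ∀ a, (√(ρ a) - √(μ a)) ^ 2 ≤ μ a * Real.log (μ a / ρ a) - μ a + ρ a := by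
    intro a
    rcases (hμ a).eq_or_lt with h0 | h0
    · simp [← h0, Real.sq_sqrt (hρ a)]
    have hρ0 : 0 < ρ a := lt_of_le_of_ne (hρ a) fun h' => h0.ne' (h a h'.symm)
    have h1 := Real.log_le_sub_one_of_pos (div_pos (Real.sqrt_pos.2 hρ0) (Real.sqrt_pos.2 h0))
    have h2 : Real.log (μ a / ρ a) = -2 * Real.log (√(ρ a) / √(μ a)) := by
      rw [Real.log_div h0.ne' hρ0.ne', Real.log_div (Real.sqrt_pos.2 hρ0).ne'
        (Real.sqrt_pos.2 h0).ne', Real.log_sqrt hρ0.le, Real.log_sqrt h0.le]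
      ring
    have h3 : μ a * (√(ρ a) / √(μ a)) = √(ρ a) * √(μ a) := by
      have h4 := Real.mul_self_sqrt h0.le
      have h5 := (Real.sqrt_pos.2 h0).ne'
      rw [← mul_div_assoc, div_eq_iff h5]
      linear_combination (-√(ρ a)) * h4
    have h4 := mul_le_mul_of_nonneg_left h1 h0.le
    rw [sub_sq, Real.sq_sqrt hρ0.le, Real.sq_sqrt h0.le, h2]
    linarith
  have h1 := Finset.sum_le_sum fun a (_ : a ∈ Finset.univ) => key a
  simp only [Finset.sum_add_distrib, Finset.sum_sub_distrib, hμ1] at h1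
  rw [hellingerDistance, klDivergence]
  linarith

theorem abs_bayesLoss_sub_le {Y : Type v} [Nonempty Y] {loss : X → Y → ℝ}
    (hl : ∀ a y, loss a y ∈ Set.Icc (0 : ℝ) 1) (hρ : ∀ a, 0 ≤ ρ a) (hμ : ∀ a, 0 ≤ μ a) :
    |bayesLoss loss ρ - bayesLoss loss μ| ≤ ∑ a, |ρ a - μ a| := by
  have key : ∀ {ρ μ : X → ℝ}, (∀ a, 0 ≤ ρ a) →
      bayesLoss loss ρ - ∑ a, |ρ a - μ a| ≤ bayesLoss loss μ := by
    intro ρ μ hρ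
    refine le_ciInf fun y => ?_
    have hbdd : BddBelow (Set.range fun y => ∑ a, loss a y * ρ a) :=
      ⟨0, by
        rintro _ ⟨y, rfl⟩
        exact Finset.sum_nonneg fun a _ => mul_nonneg (hl a y).1 (hρ a)⟩
    have h1 : bayesLoss loss ρ ≤ ∑ a, loss a y * ρ a := ciInf_le hbdd y
    have h2 : ∑ a, loss a y * ρ a ≤ ∑ a, (loss a y * μ a + |ρ a - μ a|) := by
      refine Finset.sum_le_sum fun a _ => ?_
      have h3 : loss a y * (ρ a - μ a) ≤ |ρ a - μ a| :=
        (mul_le_mul_of_nonneg_left (le_abs_self _) (hl a y).1).trans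
          (mul_le_of_le_one_left (abs_nonneg _) (hl a y).2)
      linarith
    rw [Finset.sum_add_distrib] at h2
    linarith
  rw [abs_le]
  have h1 := key (ρ := ρ) (μ := μ) hρ
  have h2 := key (ρ := μ) (μ := ρ) hμ
  simp only [abs_sub_comm (μ _)] at h2
  constructor <;> linarith

theorem squaredBayesRegret_le_klDivergence {Y : Type v} [Nonempty Y] {loss : X → Y → ℝ}
    (hl : ∀ a y, loss a y ∈ Set.Icc (0 : ℝ) 1) (hρ : ∀ a, 0 ≤ ρ a)
    (hμ : ∀ a, 0 ≤ μ a) (h : ∀ a, ρ a = 0 → μ a = 0) (hρ1 : ∑ a, ρ a ≤ 1) (hμ1 : ∑ a, μ a = 1) :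
    squaredBayesRegret loss ρ μ ≤ klDivergence ρ μ := by
  refine le_trans ?_ (squaredAbsoluteDistance_le_klDivergence hρ hμ h hρ1 hμ1)
  rw [squaredBayesRegret, squaredAbsoluteDistance]
  refine mul_le_mul_of_nonneg_left ?_ (by norm_num)
  rw [sq_le_sq]
  exact (abs_bayesLoss_sub_le hl hρ hμ).trans (le_abs_self _)

theorem klDivergence_nonneg (hρ : ∀ a, 0 ≤ ρ a)
    (hμ : ∀ a, 0 ≤ μ a) (h : ∀ a, ρ a = 0 → μ a = 0) (hρ1 : ∑ a, ρ a ≤ 1) (hμ1 : ∑ a, μ a = 1) :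
    0 ≤ klDivergence ρ μ :=
  le_trans (by positivity) (half_sq_sum_abs_add_le hρ hμ h hρ1 hμ1)

theorem IsDeviation.nonneg_and_le_klDivergence {s : (X → ℝ) → (X → ℝ) → ℝ}
    (hs : IsDeviation.{u, v} s) (hρ : ∀ a, 0 ≤ ρ a)
    (hμ : ∀ a, 0 ≤ μ a) (h : ∀ a, ρ a = 0 → μ a = 0) (hρ1 : ∑ a, ρ a ≤ 1) (hμ1 : ∑ a, μ a = 1) :
    0 ≤ s ρ μ ∧ s ρ μ ≤ klDivergence ρ μ := by
  cases hs with
  | squared => exact ⟨Finset.sum_nonneg fun a _ => sq_nonneg _,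
      squaredDistance_le_klDivergence hρ hμ h hρ1 hμ1⟩
  | squaredAbsolute => exact ⟨by rw [squaredAbsoluteDistance]; positivity,
      squaredAbsoluteDistance_le_klDivergence hρ hμ h hρ1 hμ1⟩
  | hellinger => exact ⟨Finset.sum_nonneg fun a _ => sq_nonneg _,
      hellingerDistance_le_klDivergence hρ hμ h hρ1 hμ1⟩
  | kl => exact ⟨klDivergence_nonneg hρ hμ h hρ1 hμ1, le_rfl⟩
  | regret loss hl => exact ⟨by rw [squaredBayesRegret]; positivity,
      squaredBayesRegret_le_klDivergence hl hρ hμ h hρ1 hμ1⟩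

end Pinsker

/-! ### The total deviation -/

section ChainRule

variable {X : Type u} {M μ : List X → ℝ}

theorem IsMeasure.pos_of_append [Fintype X] (hμ : IsMeasure μ) {x z : List X} (h : 0 < μ (x ++ z)) :
    0 < μ x := by
  induction z using List.reverseRecOn with
  | nil => simpa using h
  | append_singleton z a ih =>
    refine ih (lt_of_lt_of_le h ?_)
    rw [← hμ.sum_eq (x ++ z), ← List.append_assoc]
    exact Finset.single_le_sum (f := fun a => μ (x ++ z ++ [a])) (fun a _ => hμ.nonneg _)
      (Finset.mem_univ a)

theorem cond_append_singleton {ρ : List X → ℝ} {x z : List X} (h : ρ (x ++ z) ≠ 0) (a : X) :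
    cond ρ x (z ++ [a]) = cond ρ x z * predictive ρ (x ++ z) a := by
  rw [predictive, cond, cond, cond, List.append_assoc, mul_comm, div_mul_div_cancel₀ h]

theorem IsMeasure.sum_predictive [Fintype X] (hμ : IsMeasure μ) {x : List X} (h : 0 < μ x) :
    ∑ a, predictive μ x a = 1 := by
  simp only [predictive, cond]
  rw [← Finset.sum_div, hμ.sum_eq, div_self h.ne']

theorem IsSemimeasure.sum_predictive_le [Fintype X] (hM : IsSemimeasure M) {x : List X} :
    ∑ a, predictive M x a ≤ 1 := by
  simp only [predictive, cond]
  rw [← Finset.sum_div]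
  exact div_le_one_of_le₀ (hM.sum_le x) (hM.nonneg x)

/-- The Kullback-Leibler divergence of the distributions of the next `n` symbols. -/
noncomputable def blockDivergence [Fintype X] (M μ : List X → ℝ) (x : List X) (n : ℕ) : ℝ :=
  ∑ z : Fin n → X, cond μ x (List.ofFn z) *
    Real.log (cond μ x (List.ofFn z) / cond M x (List.ofFn z))

theorem blockDivergence_succ [Fintype X] (hμ : IsMeasure μ) (hM : ∀ z, 0 < μ z → 0 < M z)
    (x : List X) (hx : 0 < μ x) (n : ℕ) :
    blockDivergence M μ x (n + 1) =
      blockDivergence M μ x n + expectedDeviation klDivergence M μ x n := by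
  rw [blockDivergence, sum_ofFn_succ_last
    (fun z => cond μ x z * Real.log (cond μ x z / cond M x z)), blockDivergence,
    expectedDeviation, ← Finset.sum_add_distrib]
  refine Finset.sum_congr rfl fun z _ => ?_
  generalize List.ofFn z = z
  rcases (hμ.nonneg (x ++ z)).eq_or_lt with h0 | h0
  · have h1 : ∀ a, μ (x ++ (z ++ [a])) = 0 := by
      intro a
      by_contra h
      have h2 : 0 < μ ((x ++ z) ++ [a]) := by
        rw [List.append_assoc]
        exact lt_of_le_of_ne (hμ.nonneg _) (Ne.symm h)
      exact (hμ.pos_of_append h2).ne h0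
    simp [cond, h1, ← h0]
  · have hM0 := hM _ h0
    have hμz : 0 < cond μ x z := div_pos h0 hx
    have hMz : 0 < cond M x z := div_pos hM0 (hM x hx)
    have hterm : ∀ a, cond μ x (z ++ [a]) * Real.log (cond μ x (z ++ [a]) / cond M x (z ++ [a]))
        = cond μ x z * predictive μ (x ++ z) a * Real.log (cond μ x z / cond M x z) +
          cond μ x z * (predictive μ (x ++ z) a *
            Real.log (predictive μ (x ++ z) a / predictive M (x ++ z) a)) := by
      intro a
      rw [cond_append_singleton h0.ne', cond_append_singleton hM0.ne']
      by_cases ha : μ (x ++ z ++ [a]) = 0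
      · rw [List.append_assoc] at ha
        simp [predictive, cond, ha]
      · have ha' : 0 < μ (x ++ z ++ [a]) := lt_of_le_of_ne (hμ.nonneg _) (Ne.symm ha)
        have h1 : 0 < predictive μ (x ++ z) a := div_pos ha' h0
        have h2 : 0 < predictive M (x ++ z) a := div_pos (hM _ ha') hM0
        rw [mul_div_mul_comm, Real.log_mul (div_pos hμz hMz).ne' (div_pos h1 h2).ne']
        ring
    simp only [hterm, Finset.sum_add_distrib, ← Finset.sum_mul, ← Finset.mul_sum,
      hμ.sum_predictive h0, mul_one, klDivergence]

theorem blockDivergence_eq_sum [Fintype X] (hμ : IsMeasure μ) (hM : ∀ z, 0 < μ z → 0 < M z)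
    (x : List X) (hx : 0 < μ x) (n : ℕ) :
    blockDivergence M μ x n = ∑ k ∈ Finset.range n, expectedDeviation klDivergence M μ x k := by
  induction n with
  | zero => simp [blockDivergence, cond, div_self hx.ne', div_self (hM x hx).ne']
  | succ n ih => rw [blockDivergence_succ hμ hM x hx, ih, Finset.sum_range_succ]

/-- If `M(·|x)` is at least `μ(·|x)` divided by `B` on all sufficiently long strings, then the total
expected deviation after `x` is at most `log B`. -/
theorem summable_expectedDeviation [Fintype X] (hμ : IsMeasure μ) (hMs : IsSemimeasure M)
    (hM : ∀ z, 0 < μ z → 0 < M z) {x : List X} (hx : 0 < μ x) {B : ℝ} {N : ℕ}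
    (hB : ∀ z, N ≤ z.length → cond μ x z ≤ B * cond M x z)
    {s : (X → ℝ) → (X → ℝ) → ℝ} (hs : IsDeviation.{u, v} s) :
    Summable (expectedDeviation s M μ x) ∧
      ∑' n, expectedDeviation s M μ x n ≤ Real.log B := by
  have hcond : ∀ z, 0 ≤ cond μ x z := fun z => div_nonneg (hμ.nonneg _) (hμ.nonneg _)
  have hdev : ∀ z, 0 < μ (x ++ z) → ∀ {s}, IsDeviation.{u, v} s →
      0 ≤ s (predictive M (x ++ z)) (predictive μ (x ++ z)) ∧
        s (predictive M (x ++ z)) (predictive μ (x ++ z)) ≤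
          klDivergence (predictive M (x ++ z)) (predictive μ (x ++ z)) := by
    intro z hz s hs
    refine hs.nonneg_and_le_klDivergence (fun a => div_nonneg (hMs.nonneg _) (hMs.nonneg _))
      (fun a => div_nonneg (hμ.nonneg _) (hμ.nonneg _)) (fun a ha => ?_) hMs.sum_predictive_le
      (hμ.sum_predictive hz)
    by_contra h
    have h1 : 0 < μ (x ++ z ++ [a]) := by
      refine lt_of_le_of_ne (hμ.nonneg _) fun h' => h ?_
      simp only [predictive, cond, ← h', zero_div]
    exact (div_pos (hM _ h1) (hM _ hz)).ne' ha
  have hzero : ∀ z, ¬ 0 < μ (x ++ z) → cond μ x z = 0 := fun z hz => by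
    rw [cond, le_antisymm (not_lt.1 hz) (hμ.nonneg _), zero_div]
  have hnonneg : ∀ {s}, IsDeviation.{u, v} s → ∀ n, 0 ≤ expectedDeviation s M μ x n := by
    intro s hs n
    refine Finset.sum_nonneg fun z _ => ?_
    by_cases hz : 0 < μ (x ++ List.ofFn z)
    · exact mul_nonneg (hcond _) (hdev _ hz hs).1
    · simp [hzero _ hz]
  have hle : ∀ n, expectedDeviation s M μ x n ≤ expectedDeviation klDivergence M μ x n := by
    intro n
    refine Finset.sum_le_sum fun z _ => ?_
    by_cases hz : 0 < μ (x ++ List.ofFn z)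
    · exact mul_le_mul_of_nonneg_left (hdev _ hz hs).2 (hcond _)
    · simp [hzero _ hz]
  have hblock : ∀ n, N ≤ n → blockDivergence M μ x n ≤ Real.log B := by
    intro n hn
    have hsum : ∑ z : Fin n → X, cond μ x (List.ofFn z) = 1 := by
      simp only [cond]
      rw [← Finset.sum_div, sum_append_ofFn hμ.sum_eq, div_self hx.ne']
    calc blockDivergence M μ x n
        ≤ ∑ z : Fin n → X, cond μ x (List.ofFn z) * Real.log B := by
          refine Finset.sum_le_sum fun z _ => ?_
          by_cases hz : 0 < μ (x ++ List.ofFn z)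
          · have hMz : 0 < cond M x (List.ofFn z) := div_pos (hM _ hz) (hM x hx)
            refine mul_le_mul_of_nonneg_left (Real.log_le_log ?_ ?_) (hcond _)
            · exact div_pos (div_pos hz hx) hMz
            · rw [div_le_iff₀ hMz]
              exact hB _ (by simpa using hn)
          · simp [hzero _ hz]
      _ = Real.log B := by rw [← Finset.sum_mul, hsum, one_mul]
  have hpartial : ∀ n, ∑ k ∈ Finset.range n, expectedDeviation s M μ x k ≤ Real.log B := by
    intro n
    calc ∑ k ∈ Finset.range n, expectedDeviation s M μ x k
        ≤ ∑ k ∈ Finset.range n, expectedDeviation klDivergence M μ x k :=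
          Finset.sum_le_sum fun k _ => hle k
      _ ≤ ∑ k ∈ Finset.range (max n N), expectedDeviation klDivergence M μ x k :=
          Finset.sum_le_sum_of_subset_of_nonneg (by simp) fun k _ _ => hnonneg .kl k
      _ = blockDivergence M μ x (max n N) := (blockDivergence_eq_sum hμ hM x hx _).symm
      _ ≤ Real.log B := hblock _ (le_max_right n N)
  exact ⟨summable_of_sum_range_le (hnonneg hs) hpartial,
    Real.tsum_le_of_sum_range_le (hnonneg hs) hpartial⟩

end ChainRule

/-! ### Conditions of known length -/

section KnownLength

variable {X : Type u} [Primcodable X]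

namespace PrefixMachine

/-- The length of the part of `p` that `U`, with empty condition, has read when it halts, and the
length of `p` if `U` requests more than `p`. The prefixes are tried in order, so that this is
undefined if `U` runs forever on one of them. -/
def headerLength (U : PrefixMachine X) (p : List Bool) : Part ℕ :=
  Nat.rfind fun k => (U.next ([], p.take k)).map fun o => o.isSome || decide (p.length ≤ k)

/-- What `twiceMachine` does when it has read `q.1` from the program tape and `q.2` from the
condition tape, if the header has length `k` and `o` is what `U` does after reading it. -/
def afterHeader (U : PrefixMachine X) (q : List Bool × List X) (k : ℕ) :
    Option ℕ → Part (Bool ⊕ ℕ)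
  | none => Part.some (Sum.inl false)
  | some i => if q.2.length < i then Part.some (Sum.inl true)
      else (U.next (q.2, q.1.drop k)).map fun o => o.elim (Sum.inl false) Sum.inr

theorem partrec_headerLength (U : PrefixMachine X) : Partrec U.headerLength := by
  refine Partrec.rfind (p := fun (p : List Bool) (k : ℕ) =>
    (U.next ([], p.take k)).map fun o => o.isSome || decide (p.length ≤ k))
    (Partrec.map (U.partrec.comp (Computable.pair (Computable.const [])
      (Primrec.list_take.to_comp.comp Computable.snd Computable.fst))) ?_)
  exact Primrec.or.to_comp.comp (Primrec.option_isSome.to_comp.comp Computable.snd)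
    (Primrec.nat_le.decide.to_comp.comp
      (Computable.list_length.comp (Computable.fst.comp Computable.fst))
      (Computable.snd.comp Computable.fst))

theorem partrec_afterHeader (U : PrefixMachine X) :
    Partrec fun r : ((List Bool × List X) × ℕ) × Option ℕ => U.afterHeader r.1.1 r.1.2 r.2 := by
  let α := ((List Bool × List X) × ℕ) × Option ℕ
  have hx : Computable fun r : α => r.1.1.2 :=
    Computable.snd.comp (Computable.fst.comp Computable.fst)
  have hp : Computable fun r : α => r.1.1.1.drop r.1.2 :=
    (Primrec.list_drop (α := Bool)).to_comp.comp (Computable.snd.comp Computable.fst)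
      (Computable.fst.comp (Computable.fst.comp Computable.fst))
  have h1 : Partrec fun r : α =>
      (U.next (r.1.1.2, r.1.1.1.drop r.1.2)).map fun o =>
        (o.elim (Sum.inl false) Sum.inr : Bool ⊕ ℕ) := by
    refine Partrec.map (U.partrec.comp (Computable.pair hx hp)) ?_
    refine (Computable.option_casesOn (o := fun s : α × Option ℕ => s.2) Computable.snd
      (Computable.const (Sum.inl false : Bool ⊕ ℕ))
      (g := fun _ y => Sum.inr y) (Computable.sumInr.comp Computable.snd)).of_eq ?_
    rintro ⟨r, _ | y⟩ <;> rfl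
  have hlt : Computable fun s : α × ℕ => decide (s.1.1.1.2.length < s.2) :=
    Primrec.nat_lt.decide.to_comp.comp
      (Computable.list_length.comp (hx.comp Computable.fst)) Computable.snd
  have h2 : Partrec₂ fun (r : α) (i : ℕ) =>
      if r.1.1.2.length < i then Part.some (Sum.inl true)
      else (U.next (r.1.1.2, r.1.1.1.drop r.1.2)).map fun o =>
        (o.elim (Sum.inl false) Sum.inr : Bool ⊕ ℕ) := by
    refine (Partrec.cond hlt (Partrec.some.comp (Computable.const (Sum.inl true)))
      (h1.comp Computable.fst)).of_eq fun s => ?_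
    by_cases h : s.1.1.1.2.length < s.2 <;> simp [h]
  refine (Partrec.optionCasesOn_right (o := fun r : α => r.2) (f := fun _ => Sum.inl false)
    Computable.snd (Computable.const _) h2).of_eq ?_
  rintro ⟨r, _ | i⟩ <;> rfl

/-- The twice prefix machine that obtains a number `i` from `U` and a header of the program, then
reads `i` symbols of the condition, and then runs `U` on the rest of the program with these symbols
as condition. -/
def twiceMachine (U : PrefixMachine X) : TwicePrefixMachine X where
  next q := (U.headerLength q.1).bind fun k =>
    (U.next ([], q.1.take k)).bind fun o => U.afterHeader q k o
  partrec := by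
    refine Partrec.bind (U.partrec_headerLength.comp Computable.fst) ?_
    refine Partrec.bind (f := fun s : (List Bool × List X) × ℕ => U.next ([], s.1.1.take s.2))
      (U.partrec.comp (Computable.pair (Computable.const []) ?_)) U.partrec_afterHeader
    exact (Primrec.list_take (α := Bool)).to_comp.comp Computable.snd
      (Computable.fst.comp Computable.fst)

/-- While the header is incomplete, the machine requests program bits. -/
theorem mem_twiceMachine_next_of_prefix {U : PrefixMachine X} {q : List Bool} {i k : ℕ}
    (hq : U.Outputs q [] i) (hk : k < q.length) (x : List X) :
    Sum.inl false ∈ U.twiceMachine.next (q.take k, x) := by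
  have hlen : (q.take k).length = k := by simp [hk.le]
  have h1 : k ∈ U.headerLength (q.take k) := by
    refine Nat.mem_rfind.2 ⟨?_, fun {m} hm => ?_⟩
    · refine (Part.mem_map_iff _).2 ⟨none, ?_, by simp [hlen]⟩
      simpa [List.take_take] using hq.1 k hk
    · refine (Part.mem_map_iff _).2 ⟨none, ?_, by simp [hlen, hm]⟩
      rw [List.take_take, min_eq_left hm.le]
      exact hq.1 m (hm.trans hk)
  refine Part.mem_bind h1 (Part.mem_bind (a := none) ?_ (Part.mem_some _))
  simpa [List.take_take] using hq.1 k hk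

theorem twiceMachine_next_eq {U : PrefixMachine X} {q : List Bool} {i : ℕ}
    (hq : U.Outputs q [] i) (p : List Bool) (x : List X) :
    ∀ r ∈ U.afterHeader (q ++ p, x) q.length (some i), r ∈ U.twiceMachine.next (q ++ p, x) := by
  intro r hr
  have h1 : q.length ∈ U.headerLength (q ++ p) := by
    refine Nat.mem_rfind.2 ⟨?_, fun {m} hm => ?_⟩
    · refine (Part.mem_map_iff _).2 ⟨some i, ?_, by simp⟩
      simpa using hq.2
    · refine (Part.mem_map_iff _).2 ⟨none, ?_, by simp; omega⟩
      rw [List.take_append_of_le_length hm.le]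
      exact hq.1 m hm
  refine Part.mem_bind h1 (Part.mem_bind (a := some i) ?_ hr)
  simpa using hq.2

theorem twiceMachine_outputs {U : PrefixMachine X} {q p : List Bool} {x : List X} {i y : ℕ}
    (hq : U.Outputs q [] i) (hx : x.length = i) (hp : U.Outputs p x y) :
    U.twiceMachine.Outputs (q ++ p) x y := by
  have h1 : ∀ k, k ≤ q.length → U.twiceMachine.Reads (q.take k) [] := by
    intro k
    induction k with
    | zero => exact fun _ => by simpa using TwicePrefixMachine.Reads.start
    | succ k ih =>
      intro hk
      rw [List.take_add_one, List.getElem?_eq_getElem (by omega)]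
      exact TwicePrefixMachine.Reads.readProgram _ (ih (by omega))
        (mem_twiceMachine_next_of_prefix hq (by omega) _)
  have h2 : ∀ k, k ≤ x.length → U.twiceMachine.Reads q (x.take k) := by
    intro k
    induction k with
    | zero => exact fun _ => by simpa using h1 q.length le_rfl
    | succ k ih =>
      intro hk
      rw [List.take_add_one, List.getElem?_eq_getElem (by omega)]
      refine TwicePrefixMachine.Reads.readCondition _ (ih (by omega)) ?_
      have h := twiceMachine_next_eq hq [] (x.take k) (Sum.inl true) (by
        have : (x.take k).length < i := by rw [List.length_take]; omega
        simp only [afterHeader, if_pos this]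
        exact Part.mem_some _)
      simpa using h
  have h3 : ∀ k, k ≤ p.length → U.twiceMachine.Reads (q ++ p.take k) x := by
    intro k
    induction k with
    | zero => exact fun _ => by simpa using h2 x.length le_rfl
    | succ k ih =>
      intro hk
      rw [List.take_add_one, List.getElem?_eq_getElem (by omega), ← List.append_assoc]
      refine TwicePrefixMachine.Reads.readProgram _ (ih (by omega)) ?_
      refine twiceMachine_next_eq hq _ _ _ ?_
      have : ¬ x.length < i := by omega
      simp only [afterHeader, if_neg this]
      refine (Part.mem_map_iff _).2 ⟨none, ?_, rfl⟩
      simpa using hp.1 k (by omega)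
  refine ⟨by simpa using h3 p.length le_rfl, twiceMachine_next_eq hq _ _ _ ?_⟩
  have : ¬ x.length < i := by omega
  simp only [afterHeader, if_neg this]
  refine (Part.mem_map_iff _).2 ⟨some y, ?_, rfl⟩
  simpa using hp.2

theorem exists_outputs_length_eq_K {U : PrefixMachine X} (hU : U.IsOptimal) (y : ℕ) (x : List X) :
    ∃ p, U.Outputs p x y ∧ p.length = U.K y x := by
  have h := complexity_ne_top hU y x
  have hne : ∃ n : ℕ, ∃ p, U.Outputs p x y ∧ p.length = n := by
    by_contra hcon
    push Not at hcon
    refine h ?_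
    rw [complexity, iInf₂_eq_top]
    exact fun p hp => absurd rfl (hcon p.length p hp)
  classical
  obtain ⟨p, hp, hl⟩ := Nat.find_spec hne
  refine ⟨p, hp, ?_⟩
  have : U.complexity y x = p.length := by
    refine le_antisymm (iInf₂_le p hp) (le_iInf₂ fun r hr => ?_)
    rw [hl]
    exact_mod_cast Nat.find_min' hne ⟨r, hr, rfl⟩
  rw [K, this, ENat.toNat_natCast]

end PrefixMachine

theorem TwicePrefixMachine.exists_outputs_length_eq_KStar {W : TwicePrefixMachine X}
    (hW : W.IsOptimal) (y : ℕ) (x : List X) :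
    ∃ p z, z <+: x ∧ W.Outputs p z y ∧ p.length = W.KStar y x := by
  have h := complexity_ne_top hW y x
  have hne : ∃ n : ℕ, ∃ p, (∃ k ≤ x.length, W.Outputs p (x.take k) y) ∧ p.length = n := by
    by_contra hcon
    push Not at hcon
    refine h ?_
    rw [complexity, iInf₂_eq_top]
    exact fun p hp => absurd rfl (hcon p.length p hp)
  classical
  obtain ⟨p, hp, hl⟩ := Nat.find_spec hne
  obtain ⟨k, hk, hpk⟩ := hp
  refine ⟨p, x.take k, List.take_prefix _ _, hpk, ?_⟩
  have : W.complexity y x = p.length := by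
    refine le_antisymm (iInf₂_le p ⟨k, hk, hpk⟩) (le_iInf₂ fun r hr => ?_)
    rw [hl]
    exact_mod_cast Nat.find_min' hne ⟨r, hr, rfl⟩
  rw [KStar, this, ENat.toNat_natCast]

theorem exists_KStar_le {U : PrefixMachine X} (hU : U.IsOptimal) {W : TwicePrefixMachine X}
    (hW : W.IsOptimal) : ∃ c : ℕ, ∀ (y : ℕ) (x : List X) (i : ℕ), i ≤ x.length →
      W.KStar y x ≤ U.K y (x.take i) + U.K i [] + c := by
  obtain ⟨c, hc⟩ := hW U.twiceMachine
  refine ⟨c, fun y x i hi => ?_⟩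
  obtain ⟨q, hq, hql⟩ := PrefixMachine.exists_outputs_length_eq_K hU i []
  obtain ⟨p, hp, hpl⟩ := PrefixMachine.exists_outputs_length_eq_K hU y (x.take i)
  have h1 : U.twiceMachine.complexity y x ≤ ((q ++ p).length : ℕ∞) :=
    iInf₂_le (q ++ p) ⟨i, hi, PrefixMachine.twiceMachine_outputs hq (by simpa using hi) hp⟩
  have h2 : W.complexity y x ≤ ((U.K y (x.take i) + U.K i [] + c : ℕ) : ℕ∞) := by
    refine (hc y x).trans ?_
    rw [Nat.cast_add _ c]
    gcongr
    refine h1.trans ?_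
    rw [List.length_append, hql, hpl, add_comm]
  exact ENat.toNat_le_of_le_natCast h2

end KnownLength

/-! ### Solomonoff's prior -/

section Prior

theorem tsum_inv_two_pow_K_mul_le {X : Type u} [Primcodable X] {U : PrefixMachine X}
    (hU : U.IsOptimal) (φ : ℕ → List X → ℝ≥0∞) (x : List X) :
    ∑' T, 2⁻¹ ^ U.K T [] * φ T x ≤ programMixture U φ x := by
  rw [programMixture, ENNReal.tsum_comm]
  refine ENNReal.tsum_le_tsum fun T => ?_
  obtain ⟨q, hq, hl⟩ := PrefixMachine.exists_outputs_length_eq_K hU T []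
  refine le_trans (le_of_eq ?_) (ENNReal.le_tsum q)
  rw [if_pos hq, hl]

variable {X : Type u} [Fintype X]

theorem natCast_div_lt_ofReal (k n : ℕ) {r : ℝ} :
    (k : ℝ≥0∞) / (n + 1) < ENNReal.ofReal r ↔ (k : ℝ) / (n + 1) < r := by
  have h : (k : ℝ≥0∞) / (n + 1) = ENNReal.ofReal ((k : ℝ) / (n + 1)) := by
    rw [ENNReal.ofReal_div_of_pos (by positivity), ENNReal.ofReal_natCast,
      ENNReal.ofReal_add (by positivity) zero_le_one, ENNReal.ofReal_natCast, ENNReal.ofReal_one]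
  rw [h, ENNReal.ofReal_lt_ofReal_iff']
  exact and_iff_left_of_imp fun h' => lt_of_le_of_lt (by positivity) h'

theorem le_nil_of_sum_le {φ : List X → ℝ≥0∞} (hφ : ∀ z, ∑ a, φ (z ++ [a]) ≤ φ z) (z : List X) :
    φ z ≤ φ [] := by
  induction z using List.reverseRecOn with
  | nil => exact le_rfl
  | append_singleton z a ih =>
    exact ((Finset.single_le_sum (f := fun a => φ (z ++ [a])) (fun _ _ => zero_le)
      (Finset.mem_univ a)).trans (hφ z)).trans ih

theorem IsSemimeasure.sum_ofReal_le {ρ : List X → ℝ} (hρ : IsSemimeasure ρ) (z : List X) :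
    ∑ a, ENNReal.ofReal (ρ (z ++ [a])) ≤ ENNReal.ofReal (ρ z) := by
  rw [← ENNReal.ofReal_sum_of_nonneg fun a _ => hρ.nonneg _]
  exact ENNReal.ofReal_le_ofReal (hρ.sum_le z)

theorem IsMeasure.sum_ofReal_eq {ρ : List X → ℝ} (hρ : IsMeasure ρ) (z : List X) :
    ∑ a, ENNReal.ofReal (ρ (z ++ [a])) = ENNReal.ofReal (ρ z) := by
  rw [← ENNReal.ofReal_sum_of_nonneg fun a _ => hρ.nonneg _, hρ.sum_eq z]

theorem isSemimeasure_toReal {φ : List X → ℝ≥0∞} (hφ : ∀ z, ∑ a, φ (z ++ [a]) ≤ φ z)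
    (h1 : φ [] ≤ 1) : IsSemimeasure fun z => (φ z).toReal := by
  have htop : ∀ z, φ z ≠ ⊤ := fun z =>
    ne_top_of_le_ne_top ENNReal.one_ne_top ((le_nil_of_sum_le hφ z).trans h1)
  refine ⟨fun _ => ENNReal.toReal_nonneg, ?_, fun z => ?_⟩
  · simpa using ENNReal.toReal_mono ENNReal.one_ne_top h1
  · rw [← ENNReal.toReal_sum fun a _ => htop _]
    exact ENNReal.toReal_mono (htop z) (hφ z)

variable [Primcodable X] {U : PrefixMachine X} {ν : ℕ → List X → ℝ}

theorem ofReal_inv_two_pow_mul (n : ℕ) (r : ℝ) :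
    ENNReal.ofReal (2⁻¹ ^ n * r) = 2⁻¹ ^ n * ENNReal.ofReal r := by
  rw [ENNReal.ofReal_mul (by positivity), ENNReal.ofReal_pow (by positivity),
    ENNReal.ofReal_inv_of_pos two_pos, ENNReal.ofReal_ofNat]

theorem summable_solomonoffPrior (hU : U.IsOptimal) (hν : ∀ T, IsSemimeasure (ν T)) (x : List X) :
    Summable fun T => (2 : ℝ)⁻¹ ^ U.K T [] * ν T x := by
  have h : ∑' T, ENNReal.ofReal ((2 : ℝ)⁻¹ ^ U.K T [] * ν T x) ≠ ⊤ := by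
    simp only [ofReal_inv_two_pow_mul]
    refine ne_top_of_le_ne_top ENNReal.one_ne_top
      ((tsum_inv_two_pow_K_mul_le hU (fun T z => ENNReal.ofReal (ν T z)) x).trans
        ((le_nil_of_sum_le (sum_programMixture_le U fun T z => (hν T).sum_ofReal_le z) x).trans
          (programMixture_nil_le U fun T => ?_)))
    simpa using (hν T).root_le
  refine (ENNReal.summable_toReal h).congr fun T => ?_
  exact ENNReal.toReal_ofReal (mul_nonneg (by positivity) ((hν T).nonneg x))

theorem ofReal_solomonoffPrior_le (hU : U.IsOptimal) (hν : ∀ T, IsSemimeasure (ν T))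
    (x : List X) : ENNReal.ofReal (solomonoffPrior U ν x) ≤
      programMixture U (fun T z => ENNReal.ofReal (ν T z)) x := by
  rw [solomonoffPrior, ENNReal.ofReal_tsum_of_nonneg
    (fun T => mul_nonneg (by positivity) ((hν T).nonneg x)) (summable_solomonoffPrior hU hν x)]
  simp only [ofReal_inv_two_pow_mul]
  exact tsum_inv_two_pow_K_mul_le hU (fun T z => ENNReal.ofReal (ν T z)) x

theorem inv_two_pow_K_mul_le_solomonoffPrior (hU : U.IsOptimal) (hν : ∀ T, IsSemimeasure (ν T))
    (T : ℕ) (x : List X) : 2⁻¹ ^ U.K T [] * ν T x ≤ solomonoffPrior U ν x :=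
  (summable_solomonoffPrior hU hν x).le_tsum T fun T _ =>
    mul_nonneg (by positivity) ((hν T).nonneg x)

theorem isSemimeasure_solomonoffPrior (hU : U.IsOptimal) (hν : ∀ T, IsSemimeasure (ν T)) :
    IsSemimeasure (solomonoffPrior U ν) := by
  refine ⟨fun x => tsum_nonneg fun T => mul_nonneg (by positivity) ((hν T).nonneg x), ?_,
    fun x => ?_⟩
  · rw [← ENNReal.ofReal_le_one]
    refine (ofReal_solomonoffPrior_le hU hν []).trans (programMixture_nil_le U fun T => ?_)
    simpa using (hν T).root_le
  · simp only [solomonoffPrior]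
    rw [← Summable.tsum_finsetSum fun a _ => summable_solomonoffPrior hU hν (x ++ [a])]
    refine Summable.tsum_le_tsum (fun T => ?_)
      (summable_sum fun a _ => summable_solomonoffPrior hU hν (x ++ [a]))
      (summable_solomonoffPrior hU hν x)
    rw [← Finset.mul_sum]
    exact mul_le_mul_of_nonneg_left ((hν T).sum_le x) (by positivity)

theorem codeScale_encode (d : ℤ) :
    codeScale (Encodable.encode d) = ENNReal.ofReal (2 ^ (d - 1)) := by
  rw [two_zpow_eq, ofReal_inv_two_pow_mul, ENNReal.ofReal_pow two_pos.le, ENNReal.ofReal_ofNat,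
    codeScale]

/-- The prediction of Solomonoff's prior `M` after `x` dominates that of a measure `μ = ν T`, up to
a factor whose logarithm is `K_*(T|x*) + K(⌈d_μ(x)⌉)` up to a constant. This only holds for
sufficiently long continuations. -/
theorem exists_cond_le_mul_cond_solomonoffPrior (hU : U.IsOptimal) {W : TwicePrefixMachine X}
    (hW : W.IsOptimal) (hν : IsSemimeasureEnumeration ν) :
    ∃ C : ℕ, ∀ T, IsMeasure (ν T) → ∀ x, 0 < ν T x → ∃ N : ℕ, ∀ z, N ≤ z.length →
      cond (ν T) x z ≤
        2 ^ (W.KStar T x + U.KInt ⌈deficiency (solomonoffPrior U ν) (ν T) x⌉ + C) *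
          cond (solomonoffPrior U ν) x z := by
  classical
  set M := solomonoffPrior U ν with hMdef
  have hs := hν.isSemimeasure
  let φ : ℕ → List X → ℝ≥0∞ := fun T z => ENNReal.ofReal (ν T z)
  have hφ : ∀ T z, ∑ a, φ T (z ++ [a]) ≤ φ T z := fun T z => (hs T).sum_ofReal_le z
  have hφ1 : ∀ T, φ T [] ≤ 1 := fun T => by simpa [φ] using (hs T).root_le
  have hφc : LowerSemicomputable fun q : ℕ × List X => φ q.1 q.2 :=
    lowerSemicomputable_of_rePred
      (hν.enumerable.of_eq fun q => (natCast_div_lt_ofReal q.2.1 q.2.2).symm)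
  obtain ⟨D, hD, -, hDs⟩ := rePred_exists_stage (rePred_largeDeficiency U hφc)
  let d : ℕ × ℕ → List X → ℕ → Bool := fun r v s => D (r.2, v, r.1) s
  have hd : Computable fun q : ((ℕ × ℕ) × List X) × ℕ => d q.1.1 q.1.2 q.2 :=
    hD.comp (Computable.pair (Computable.snd.comp (Computable.fst.comp Computable.fst))
      (Computable.pair (Computable.snd.comp Computable.fst)
        (Computable.fst.comp (Computable.fst.comp Computable.fst)))) Computable.snd
  have hR := sum_dominatingSemimeasure_le U W hφ d
  have hR1 : dominatingSemimeasure U W φ d [] ≤ 1 :=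
    dominatingSemimeasure_nil_le U W hφ (sum_programMixture_le U hφ)
      (programMixture_nil_le U hφ1) fun n T v s h =>
        LargeDeficiency.scale_mul_le (q := (T, v, n)) hφ hφ1 ((hDs _).2 ⟨s, h⟩)
  have hRtop : ∀ z, dominatingSemimeasure U W φ d z ≠ ⊤ := fun z =>
    ne_top_of_le_ne_top ENNReal.one_ne_top ((le_nil_of_sum_le hR z).trans hR1)
  -- The index of the dominating semimeasure depends on `U`, `W` and `ν` only.
  obtain ⟨T₀, hT₀⟩ := hν.complete (fun z => (dominatingSemimeasure U W φ d z).toReal)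
    (isSemimeasure_toReal hR hR1)
    ((((lowerSemicomputable_dominatingSemimeasure U W hφc hd).comp
      (Computable.fst (α := List X) (β := ℕ × ℕ))).rePred_lt
        (Computable.fst.comp Computable.snd) (Computable.snd.comp Computable.snd)).of_eq fun q => by
      rw [← natCast_div_lt_ofReal, ENNReal.ofReal_toReal (hRtop _)])
  refine ⟨U.K T₀ [] + 1, fun T hT x hx => ?_⟩
  set e := ⌈deficiency M (ν T) x⌉ with he
  have hMpos : ∀ z, 0 < ν T z → 0 < M z := fun z hz =>
    lt_of_lt_of_le (by positivity) (inv_two_pow_K_mul_le_solomonoffPrior hU hs T z)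
  have hMx := hMpos x hx
  have hlog : (2 : ℝ) ^ deficiency M (ν T) x = M x / ν T x :=
    Real.rpow_logb two_pos (by norm_num) (div_pos hMx hx)
  -- Here `d_μ(x) ≤ e < d_μ(x) + 1` is used: `hlow` makes `x` recognizable, and `hupp` allows to
  -- pass from `M(xz)` to `M(z|x)`.
  have hlow : (2 : ℝ) ^ (e - 1) * ν T x < M x := by
    rw [← lt_div_iff₀ hx, ← hlog, ← Real.rpow_intCast]
    refine Real.rpow_lt_rpow_of_exponent_lt (by norm_num) ?_
    push_cast
    linarith [Int.ceil_lt_add_one (deficiency M (ν T) x)]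
  have hupp : M x ≤ (2 : ℝ) ^ e * ν T x := by
    rw [← div_le_iff₀ hx, ← hlog, ← Real.rpow_intCast]
    exact Real.rpow_le_rpow_of_exponent_le (by norm_num) (Int.le_ceil _)
  have hlarge : LargeDeficiency (programMixture U φ) φ (T, x, Encodable.encode e) := by
    refine largeDeficiency_of_lt (fun z => hT.sum_ofReal_eq z) (by simp [φ, hT.root_eq]) ?_
    refine lt_of_lt_of_le ?_ (ofReal_solomonoffPrior_le hU hs x)
    rw [codeScale_encode, ← ENNReal.ofReal_mul (by positivity)]
    exact (ENNReal.ofReal_lt_ofReal_iff hMx).2 hlow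
  obtain ⟨s, hs'⟩ := (hDs _).1 hlarge
  obtain ⟨q, hq, hql⟩ := PrefixMachine.exists_outputs_length_eq_K hU (Encodable.encode e) []
  obtain ⟨p, y, hyx, hp, hpl⟩ := TwicePrefixMachine.exists_outputs_length_eq_KStar hW T x
  obtain ⟨N, hN⟩ := exists_le_dominatingSemimeasure (ν := φ) (d := d) hq hp hyx
    (s := s) (by exact hs')
  refine ⟨N, fun z hz => ?_⟩
  have h1 : 2⁻¹ ^ q.length * (2⁻¹ ^ p.length * (2 ^ (e - 1) * ν T (x ++ z))) ≤ ν T₀ (x ++ z) := by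
    have h := hN (x ++ z) (List.prefix_append _ _) (by rw [List.length_append]; omega)
    rw [codeScale_encode, ← ENNReal.ofReal_mul (by positivity), ← ofReal_inv_two_pow_mul,
      ← ofReal_inv_two_pow_mul] at h
    rw [hT₀]
    exact (ENNReal.ofReal_le_iff_le_toReal (hRtop _)).1 h
  have h2 := inv_two_pow_K_mul_le_solomonoffPrior hU hs T₀ (x ++ z)
  rw [← hMdef] at h2
  have h3 : 2⁻¹ ^ U.K T₀ [] * (2⁻¹ ^ q.length * (2⁻¹ ^ p.length * (2 ^ (e - 1) * ν T (x ++ z))))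
      ≤ M (x ++ z) :=
    (mul_le_mul_of_nonneg_left h1 (by positivity)).trans h2
  have h4 : (2 : ℝ) ^ e * ν T (x ++ z) ≤
      2 ^ (p.length + q.length + (U.K T₀ [] + 1)) * M (x ++ z) := by
    have h5 := mul_le_mul_of_nonneg_left h3
      (by positivity : (0 : ℝ) ≤ 2 ^ (p.length + q.length + (U.K T₀ [] + 1)))
    refine le_trans (le_of_eq ?_) h5
    rw [zpow_sub_one₀ two_ne_zero]
    simp only [pow_add, inv_pow, pow_one]
    field_simp
  rw [PrefixMachine.KInt, ← hql, ← hpl, cond, cond, ← mul_div_assoc, div_le_div_iff₀ hx hMx]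
  calc ν T (x ++ z) * M x ≤ ν T (x ++ z) * (2 ^ e * ν T x) :=
        mul_le_mul_of_nonneg_left hupp (hT.nonneg _)
    _ = 2 ^ e * ν T (x ++ z) * ν T x := by ring
    _ ≤ _ := mul_le_mul_of_nonneg_right h4 hx.le

end Prior
end AlgorithmicPrediction

theorem mainTheorem7 {X : Type u} [Fintype X] [Primcodable X]
    (U : PrefixMachine X) (hU : U.IsOptimal)
    (W : TwicePrefixMachine X) (hW : W.IsOptimal)
    (ν : ℕ → List X → ℝ) (hν : IsSemimeasureEnumeration ν) :
    ∃ c : ℝ, ∀ μ : List X → ℝ, IsComputableMeasure μ → ∀ T : ℕ, ν T = μ →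
      ∀ x : List X, 0 < μ x →
        (∀ s : (X → ℝ) → (X → ℝ) → ℝ, IsDeviation.{u, v} s →
          Summable (expectedDeviation s (solomonoffPrior U ν) μ x) ∧
          ∑' n, expectedDeviation s (solomonoffPrior U ν) μ x n ≤
            ((W.KStar T x : ℝ) + U.KInt ⌈deficiency (solomonoffPrior U ν) μ x⌉)
              * Real.log 2 + c) ∧
        ((W.KStar T x : ℝ) + U.KInt ⌈deficiency (solomonoffPrior U ν) μ x⌉) * Real.log 2 ≤
          (((Finset.range (x.length + 1)).inf' Finset.nonempty_range_add_one
              (fun i => U.K T (x.take i) + U.K i []) : ℕ)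
            + (U.KInt ⌈deficiency (solomonoffPrior U ν) μ x⌉ : ℝ)) * Real.log 2 + c := by
  obtain ⟨C, hC⟩ := exists_cond_le_mul_cond_solomonoffPrior hU hW hν
  obtain ⟨c, hc⟩ := exists_KStar_le hU hW
  have hlog2 : 0 < Real.log 2 := Real.log_pos one_lt_two
  refine ⟨(C + c : ℝ) * Real.log 2, ?_⟩
  rintro _ hμ T rfl x hx
  refine ⟨fun s hs => ?_, ?_⟩
  · obtain ⟨N, hN⟩ := hC T hμ.isMeasure x hx
    have h := summable_expectedDeviation hμ.isMeasure
      (isSemimeasure_solomonoffPrior hU hν.isSemimeasure) (fun z hz => lt_of_lt_of_le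
        (by positivity) (inv_two_pow_K_mul_le_solomonoffPrior hU hν.isSemimeasure T z)) hx hN hs
    refine ⟨h.1, h.2.trans ?_⟩
    rw [Real.log_pow]
    push_cast
    have : 0 ≤ (c : ℝ) * Real.log 2 := by positivity
    linarith
  · obtain ⟨i, hi, hmin⟩ := Finset.exists_mem_eq_inf'
      (Finset.nonempty_range_add_one (n := x.length)) (fun i => U.K T (x.take i) + U.K i [])
    rw [hmin]
    have h := hc T x i (by simpa [Nat.lt_succ_iff] using hi)
    have h' : (W.KStar T x : ℝ) ≤ ((U.K T (x.take i) + U.K i [] : ℕ) : ℝ) + c := by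
      exact_mod_cast h
    have h1 := mul_le_mul_of_nonneg_right h' hlog2.le
    have : 0 ≤ (C : ℝ) * Real.log 2 := by positivity
    linarith
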